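/- Consider the focusing cubic nonlinear Schr\"odinger equation on the line, $$ i u_t + u_{xx} + 2|u|^2 u = 0, \qquad u=u(t,x)\in\mathbb{C},\ (t,x)\in\mathbb{R}^2. \tag{NLS} $$ There is $\varepsilon_0>0$ such that for every $\varepsilon\in(0,\varepsilon_0)$ there is a constant $C>0$, depending only on $\varepsilon$, with the following property. Let $q\in C(\mathbb{R};H^3(\mathbb{R}))$ be a solution of (NLS) with $\|q(0,\cdot)\|_{L^2}<\varepsilon$. Let $\boldsymbol\varphi=(\varphi_1,\varphi_2)$ and $\boldsymbol\chi=(\chi_1,\chi_2)$ be complex vector functions of $(t,x)$ which both solve, for all $t,x\in\mathbb{R}$, the linear equation $$ \partial_t \begin{bmatrix} v_1\\ v_2\end{bmatrix} = i\begin{bmatrix} \tfrac12+|q|^2 & \partial_x q+q\\ \partial_x\bar q-\bar q & -\tfrac12-|q|^2\end{bmatrix}\begin{bmatrix} v_1\\ v_2\end{bmatrix} $$ and which at $t=0$ solve the boundary value problems $$ \varphi_1'=q\varphi_2,\quad \varphi_2'=-\bar q\varphi_1-\varphi_2,\quad \lim_{x\to\infty}\varphi_1(x)=1,\quad \lim_{x\to-\infty}e^{x}\varphi_2(x)=0,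 $$ $$ \chi_1'=\chi_1+q\chi_2,\quad \chi_2'=-\bar q\chi_1,\quad \lim_{x\to\infty}e^{-x}\chi_1(x)=0,\quad \lim_{x\to-\infty}\chi_2(x)=-1, $$ with $q=q(0,x)$. Let $a\in\mathbb{C}\setminus\{0\}$, $\gamma,\theta\in\mathbb{R}$, $c_1=ae^{(\gamma+i\theta)/2}$, $c_2=ae^{-(\gamma+i\theta)/2}$, and $$ \psi_j(t,x)=c_1e^{x/2}\varphi_j(t,x)+c_2e^{-x/2}\chi_j(t,x)\qquad (j=1,2). $$ Then $|\psi_1|^2+|\psi_2|^2$ vanishes nowhere, the function $$ Q(t,x)=-q(t,x)-\frac{2\psi_1(t,x)\overline{\psi_2(t,x)}}{|\psi_1(t,x)|^2+|\psi_2(t,x)|^2} $$ belongs to $C(\mathbb{R};H^3(\mathbb{R}))$ and is a solution of (NLS), and $$ \sup_{t\in\mathbb{R}}\bigl\|Q(t,\cdot)-e^{i(t+\theta)}\operatorname{sech}(\cdot+\gamma)\bigr\|_{L^2}\le C\,\|q(0,\cdot)\|_{L^2}. $$ -/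

import Mathlib

open MeasureTheory Filter Topology
open scoped ContDiff ComplexConjugate

noncomputable section

namespace BacklundNLS

/-- `g` is the weak derivative of `f` on the real line. -/
def IsWeakDeriv (f g : ℝ → ℂ) : Prop :=
  LocallyIntegrable f volume ∧ LocallyIntegrable g volume ∧
    ∀ ζ : ℝ → ℝ, ContDiff ℝ ∞ ζ → HasCompactSupport ζ →
      ∫ x, f x * ((deriv ζ x : ℝ) : ℂ) = -∫ x, g x * (ζ x : ℂ)

/-- `u ∈ C(ℝ; H^m(ℝ))`, where `u t x` is a function of time `t` and position `x`: for each `t` the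
function `u t` has weak derivatives `D k t` of order `k ≤ m`, all of them in `L²(ℝ)`, and
`t ↦ D k t` is continuous in `L²(ℝ)` for `k ≤ m`.  As usual for `m ≥ 1`, an element of
`H^m(ℝ)` is identified with its continuous representative. -/
def ContinuousInSobolev (m : ℕ) (u : ℝ → ℝ → ℂ) : Prop :=
  (∀ t, Continuous (u t)) ∧
    ∃ D : ℕ → ℝ → ℝ → ℂ, D 0 = u ∧
      (∀ k < m, ∀ t, IsWeakDeriv (D k t) (D (k + 1) t)) ∧
      (∀ k ≤ m, ∀ t, MemLp (D k t) 2 volume) ∧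
      ∀ k ≤ m, ∀ t₀, Tendsto (fun t => eLpNorm (D k t - D k t₀) 2 volume) (𝓝 t₀) (𝓝 0)

/-- `u ∈ C(ℝ; H³(ℝ))` solves `i u_t + u_xx + 2 |u|² u = 0`.  Since `H³(ℝ) ⊂ C²(ℝ)`, the second
derivative in `x` is a classical one; `u_xx + 2 |u|² u` is then continuous in time with values in
`H¹(ℝ)`, so the equation in `H¹(ℝ)` is the same as the equation at every point `(t, x)`. -/
structure IsH3SolutionNLS (u : ℝ → ℝ → ℂ) : Prop where
  continuousInSobolev : ContinuousInSobolev 3 u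
  differentiableAt_time : ∀ t x, DifferentiableAt ℝ (fun s => u s x) t
  equation : ∀ t x, Complex.I * deriv (fun s => u s x) t + deriv (deriv (u t)) x
    + 2 * (‖u t x‖ : ℂ) ^ 2 * u t x = 0

/-- `(φ₁, φ₂)` solves the boundary value problem
`φ₁' = q φ₂`, `φ₂' = -q̄ φ₁ - φ₂`, `φ₁(x) → 1` as `x → ∞`, `e^x φ₂(x) → 0` as `x → -∞`. -/
structure IsJostPhi (q φ₁ φ₂ : ℝ → ℂ) : Prop where
  hasDerivAt_fst : ∀ x, HasDerivAt φ₁ (q x * φ₂ x) x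
  hasDerivAt_snd : ∀ x, HasDerivAt φ₂ (-conj (q x) * φ₁ x - φ₂ x) x
  tendsto_fst : Tendsto φ₁ atTop (𝓝 1)
  tendsto_snd : Tendsto (fun x : ℝ => (Real.exp x : ℂ) * φ₂ x) atBot (𝓝 0)

/-- `(χ₁, χ₂)` solves the boundary value problem
`χ₁' = χ₁ + q χ₂`, `χ₂' = -q̄ χ₁`, `e^{-x} χ₁(x) → 0` as `x → ∞`, `χ₂(x) → -1` as `x → -∞`. -/
structure IsJostChi (q χ₁ χ₂ : ℝ → ℂ) : Prop where
  hasDerivAt_fst : ∀ x, HasDerivAt χ₁ (χ₁ x + q x * χ₂ x) x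
  hasDerivAt_snd : ∀ x, HasDerivAt χ₂ (-conj (q x) * χ₁ x) x
  tendsto_fst : Tendsto (fun x : ℝ => (Real.exp (-x) : ℂ) * χ₁ x) atTop (𝓝 0)
  tendsto_snd : Tendsto χ₂ atBot (𝓝 (-1))

/-- The time equation of the Lax pair with spectral parameter `η = 1/2`, for every `(t, x)`. -/
structure SolvesLaxTime (q v₁ v₂ : ℝ → ℝ → ℂ) : Prop where
  hasDerivAt_fst : ∀ t x, HasDerivAt (fun s => v₁ s x)
    (Complex.I * ((1 / 2 + (‖q t x‖ : ℂ) ^ 2) * v₁ t x + (deriv (q t) x + q t x) * v₂ t x)) t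
  hasDerivAt_snd : ∀ t x, HasDerivAt (fun s => v₂ s x)
    (Complex.I * ((conj (deriv (q t) x) - conj (q t x)) * v₁ t x
      - (1 / 2 + (‖q t x‖ : ℂ) ^ 2) * v₂ t x)) t

/-- `c₁ e^{x/2} φ(t,x) + c₂ e^{-x/2} χ(t,x)` with `c₁ = a e^{(γ+iθ)/2}`, `c₂ = a e^{-(γ+iθ)/2}`,
for one component `φ`, `χ` of the two vector functions. -/
def superpose (a : ℂ) (γ θ : ℝ) (φ χ : ℝ → ℝ → ℂ) (t x : ℝ) : ℂ :=
  a * Complex.exp ((γ + Complex.I * θ) / 2) * Real.exp (x / 2) * φ t x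
    + a * Complex.exp (-(γ + Complex.I * θ) / 2) * Real.exp (-x / 2) * χ t x

/-- The Bäcklund transform `Q = -q - 2 ψ₁ ψ̄₂ / (|ψ₁|² + |ψ₂|²)`. -/
def backlund (q ψ₁ ψ₂ : ℝ → ℝ → ℂ) (t x : ℝ) : ℂ :=
  -q t x - 2 * ψ₁ t x * conj (ψ₂ t x) / ((‖ψ₁ t x‖ ^ 2 + ‖ψ₂ t x‖ ^ 2 : ℝ) : ℂ)

/-- The soliton profile `sech`. -/
def sech (x : ℝ) : ℝ := 1 / Real.cosh x

end BacklundNLS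

end

/-!
The vector `ψ` solves both equations of the Lax pair of (NLS), so the entries of the orthogonal
projection onto the line spanned by `ψ` satisfy a closed system of differential equations in `x` and
`t`. This system alone shows that `Q = -q - 2 ψ₁ ψ̄₂ / |ψ|²` solves (NLS), and its equation in `x`
trades each derivative of the projection for one of `q`, so that `Q` is as regular as `q` once the
projection is in `L²`.

For the distance to the soliton, note that up to the phases `e^{∓it/2}` the vectors `φ` and `χ` stay
Jost solutions of `q(t, ·)` at all times, while the mass `‖q(t, ·)‖` is conserved. Hence it suffices
to consider one fixed small potential. For `q = 0` the vector `ψ` is a multiple of `(e^z, -e^{-z})`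
with `2z = x + γ + i(t + θ)`, and the transform is exactly the soliton. In general `φ₁ - 1` and
`χ₂ + 1` are uniformly small and, by the damping in their equations, `φ₂` and `χ₁` are small both
uniformly and in `L²`. The two projections differ by at most the sine of the angle between
`ψ` and `(e^z, -e^{-z})`. In the determinant of these two vectors
`φ₁ - 1` and `χ₂ + 1` enter without an exponential weight, so that they contribute at most a small
multiple of the square integrable `sech(x + γ)`, and `φ₂` and `χ₁` contribute `O(|φ₂| + |χ₁|)`.
-/

noncomputable section

namespace BacklundNLS

/-! ### Weak derivatives on the line -/

section WeakDerivative

variable {E : Type*} [NormedAddCommGroup E]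

lemma exists_tsupport_subset_Ioo {f : ℝ → E} (hc : HasCompactSupport f) :
    ∃ R : ℝ, 0 < R ∧ tsupport f ⊆ Set.Ioo (-R) R := by
  obtain ⟨R, hR, h⟩ := hc.isCompact.isBounded.exists_pos_norm_lt
  exact ⟨R, hR, fun x hx => abs_lt.1 (h x hx)⟩

lemma intervalIntegrable_of_locallyIntegrable {g : ℝ → E} (hg : LocallyIntegrable g) (a b : ℝ) :
    IntervalIntegrable g volume a b :=
  intervalIntegrable_iff.mpr <|
    (hg.integrableOn_isCompact isCompact_uIcc).mono_set Set.uIoc_subset_uIcc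

lemma continuous_deriv_of_contDiff_infty {ζ : ℝ → ℝ} (hζ : ContDiff ℝ ∞ ζ) :
    Continuous (deriv ζ) :=
  (contDiff_infty_iff_deriv.1 hζ).2.continuous

variable [NormedSpace ℝ E]

lemma continuous_primitive_of_locallyIntegrable {g : ℝ → E} (hg : LocallyIntegrable g) :
    Continuous fun x => ∫ s in (0 : ℝ)..x, g s :=
  intervalIntegral.continuous_primitive (intervalIntegrable_of_locallyIntegrable hg) 0

lemma integral_deriv_mul_primitive {g ζ : ℝ → ℝ} (hg : LocallyIntegrable g)
    (hζ : ContDiff ℝ 1 ζ) (hc : HasCompactSupport ζ) :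
    ∫ x, deriv ζ x * (∫ s in (0 : ℝ)..x, g s) = -∫ x, ζ x * g x := by
  obtain ⟨R, hR, hsupp⟩ := exists_tsupport_subset_Ioo hc
  have hIoc : tsupport ζ ⊆ Set.Ioc (-R) R := hsupp.trans Set.Ioo_subset_Ioc_self
  have hζR : ζ R = 0 := image_eq_zero_of_notMem_tsupport fun h => lt_irrefl R (hsupp h).2
  have hζR' : ζ (-R) = 0 := image_eq_zero_of_notMem_tsupport fun h => lt_irrefl _ (hsupp h).1
  have hprim := (intervalIntegrable_of_locallyIntegrable hg (-R)
    R).absolutelyContinuousOnInterval_intervalIntegral (c := 0)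
      (Set.mem_uIcc_of_le (by linarith) hR.le)
  have hparts := hζ.contDiffOn.absolutelyContinuousOnInterval.integral_mul_deriv_eq_deriv_mul hprim
  rw [hζR, hζR', zero_mul, zero_mul, sub_zero, zero_sub] at hparts
  rw [← intervalIntegral.integral_eq_integral_of_support_subset (a := -R) (b := R)
      (((Function.support_mul_subset_left _ _).trans (support_deriv_subset)).trans hIoc),
    ← intervalIntegral.integral_eq_integral_of_support_subset (a := -R) (b := R)
      (((Function.support_mul_subset_left _ _).trans (subset_tsupport ζ)).trans hIoc),
    eq_neg_iff_add_eq_zero, ← neg_eq_iff_add_eq_zero, ← hparts]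
  refine intervalIntegral.integral_congr_ae ?_
  filter_upwards [LocallyIntegrable.ae_hasDerivAt_integral hg] with x hx _
  rw [(hx 0).deriv]

lemma integral_deriv_smul_primitive [CompleteSpace E] {g : ℝ → E} {ζ : ℝ → ℝ}
    (hg : LocallyIntegrable g) (hζ : ContDiff ℝ ∞ ζ) (hc : HasCompactSupport ζ) :
    ∫ x, deriv ζ x • (∫ s in (0 : ℝ)..x, g s) = -∫ x, ζ x • g x := by
  rw [SeparatingDual.eq_iff_forall_dual_eq (R := ℝ)]
  intro L
  have hLg : LocallyIntegrable (L ∘ g) := fun x => L.integrableAtFilter_comp (hg x)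
  have hreal := integral_deriv_mul_primitive hLg (hζ.of_le (by exact_mod_cast le_top)) hc
  rw [map_neg, ← L.integral_comp_comm, ← L.integral_comp_comm]
  · simpa only [map_smul, smul_eq_mul, Function.comp_apply, L.intervalIntegral_comp_comm
      (intervalIntegrable_of_locallyIntegrable hg _ _)] using hreal
  · exact hg.integrable_smul_left_of_hasCompactSupport hζ.continuous hc
  · exact (continuous_primitive_of_locallyIntegrable
      hg).locallyIntegrable.integrable_smul_left_of_hasCompactSupport
        (continuous_deriv_of_contDiff_infty hζ) hc.deriv

lemma exists_contDiff_hasCompactSupport_deriv_eq {θ : ℝ → ℝ} (hθ : ContDiff ℝ ∞ θ)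
    (hc : HasCompactSupport θ) (h0 : ∫ x, θ x = 0) :
    ∃ ζ : ℝ → ℝ, ContDiff ℝ ∞ ζ ∧ HasCompactSupport ζ ∧ deriv ζ = θ := by
  obtain ⟨R, _, hsupp⟩ := exists_tsupport_subset_Ioo hc
  have hzero : ∀ x, x ∉ Set.Ioo (-R) R → θ x = 0 := fun x hx =>
    image_eq_zero_of_notMem_tsupport fun h => hx (hsupp h)
  have hder : ∀ x, HasDerivAt (fun x => ∫ s in (-R)..x, θ s) (θ x) x := fun x =>
    (hθ.continuous.integral_hasStrictDerivAt _ x).hasDerivAt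
  have hd : deriv (fun x => ∫ s in (-R)..x, θ s) = θ := funext fun x => (hder x).deriv
  refine ⟨fun x => ∫ s in (-R)..x, θ s, ?_, ?_, hd⟩
  · rw [contDiff_infty_iff_deriv, hd]
    exact ⟨fun x => (hder x).differentiableAt, hθ⟩
  · refine HasCompactSupport.intro (isCompact_Icc (a := -R) (b := R)) fun x hx => ?_
    rw [Set.mem_Icc, not_and_or, not_le, not_le] at hx
    rcases hx with hx | hx
    · refine (intervalIntegral.integral_congr (g := fun _ => 0) fun s hs => ?_).trans (by simp)
      rw [Set.uIcc_of_ge hx.le] at hs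
      exact hzero s fun h => absurd h.1 (not_lt.2 hs.2)
    · rw [← h0]
      exact intervalIntegral.integral_eq_integral_of_support_subset fun s hs =>
        ⟨(hsupp (subset_tsupport θ hs)).1, (hsupp (subset_tsupport θ hs)).2.le.trans hx.le⟩

/-- The lemma of du Bois-Reymond. -/
lemma ae_eq_const_of_integral_deriv_smul_eq_zero [CompleteSpace E] {h : ℝ → E}
    (hh : LocallyIntegrable h)
    (H : ∀ ζ : ℝ → ℝ, ContDiff ℝ ∞ ζ → HasCompactSupport ζ → ∫ x, deriv ζ x • h x = 0) :
    ∃ c : E, ∀ᵐ x, h x = c := by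
  let b : ContDiffBump (0 : ℝ) := ⟨1, 2, by norm_num, by norm_num⟩
  let ρ : ℝ → ℝ := b.normed volume
  have hρ : ContDiff ℝ ∞ ρ := b.contDiff_normed
  have hρc : HasCompactSupport ρ := b.hasCompactSupport_normed
  let c : E := ∫ x, ρ x • h x
  suffices hmain : ∀ η : ℝ → ℝ, ContDiff ℝ ∞ η → HasCompactSupport η →
      ∫ x, η x • (h x - c) = 0 by
    refine ⟨c, ?_⟩
    filter_upwards [ae_eq_zero_of_integral_contDiff_smul_eq_zero
      (hh.sub (locallyIntegrable_const c)) hmain] with x hx using sub_eq_zero.1 hx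
  intro η hη hηc
  let m : ℝ := ∫ x, η x
  have hηi : Integrable η := hη.continuous.integrable_of_hasCompactSupport hηc
  have hρi : Integrable ρ := hρ.continuous.integrable_of_hasCompactSupport hρc
  have hηh := hh.integrable_smul_left_of_hasCompactSupport hη.continuous hηc
  have hρh := hh.integrable_smul_left_of_hasCompactSupport hρ.continuous hρc
  have hmean : ∫ x, (η x - m * ρ x) = 0 := by
    rw [integral_sub hηi (hρi.const_mul m), integral_const_mul, b.integral_normed, mul_one,
      sub_self]
  obtain ⟨ζ, hζ, hζc, hζd⟩ := exists_contDiff_hasCompactSupport_deriv_eq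
    (hη.sub (contDiff_const.mul hρ)) (hηc.sub hρc.mul_left) hmean
  calc ∫ x, η x • (h x - c) = (∫ x, η x • h x) - m • c := by
        simp only [smul_sub]
        rw [integral_sub hηh (hηi.smul_const c), integral_smul_const]
    _ = ∫ x, (η x - m * ρ x) • h x := by
        simp only [sub_smul, mul_smul]
        rw [integral_sub hηh (hρh.fun_smul m), integral_smul]
    _ = 0 := by rw [← H ζ hζ hζc, hζd]

end WeakDerivative

lemma isWeakDeriv_iff_integral_smul {f g : ℝ → ℂ} :
    IsWeakDeriv f g ↔ LocallyIntegrable f ∧ LocallyIntegrable g ∧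
      ∀ ζ : ℝ → ℝ, ContDiff ℝ ∞ ζ → HasCompactSupport ζ →
        ∫ x, deriv ζ x • f x = -∫ x, ζ x • g x := by
  simp only [IsWeakDeriv, Complex.real_smul, mul_comm]

namespace IsWeakDeriv

variable {f g f' g' : ℝ → ℂ}

lemma ae_eq_primitive (h : IsWeakDeriv f g) :
    ∃ c : ℂ, ∀ᵐ x, f x = c + ∫ s in (0 : ℝ)..x, g s := by
  obtain ⟨hf, hg, H⟩ := isWeakDeriv_iff_integral_smul.1 h
  have hG := (continuous_primitive_of_locallyIntegrable hg).locallyIntegrable (μ := volume)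
  obtain ⟨c, hc⟩ := ae_eq_const_of_integral_deriv_smul_eq_zero (hf.sub hG) fun ζ hζ hζc => by
    have hζ' := continuous_deriv_of_contDiff_infty hζ
    simp only [Pi.sub_apply, smul_sub]
    rw [integral_sub (hf.integrable_smul_left_of_hasCompactSupport hζ' hζc.deriv)
      (hG.integrable_smul_left_of_hasCompactSupport hζ' hζc.deriv), H ζ hζ hζc,
      integral_deriv_smul_primitive hg hζ hζc, sub_self]
  exact ⟨c, hc.mono fun x hx => sub_eq_iff_eq_add.1 hx⟩

lemma congr_left (h : IsWeakDeriv f g) (hf : f =ᵐ[volume] f') : IsWeakDeriv f' g := by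
  refine ⟨h.1.congr hf, h.2.1, fun ζ hζ hc => ?_⟩
  rw [← h.2.2 ζ hζ hc]
  exact integral_congr_ae (hf.symm.mono fun x hx => by simp only [hx])

lemma sub_eq_integral (h : IsWeakDeriv f g) (hf : Continuous f) (x y : ℝ) :
    f y - f x = ∫ s in x..y, g s := by
  obtain ⟨c, hc⟩ := h.ae_eq_primitive
  have hG := continuous_primitive_of_locallyIntegrable h.2.1
  have heq : f = fun x => c + ∫ s in (0 : ℝ)..x, g s :=
    (hf.ae_eq_iff_eq volume (continuous_const.add hG)).1 hc
  rw [heq]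
  simp only [add_sub_add_left_eq_sub]
  exact intervalIntegral.integral_interval_sub_left
    (intervalIntegrable_of_locallyIntegrable h.2.1 _ _)
    (intervalIntegrable_of_locallyIntegrable h.2.1 _ _)

lemma exists_continuous (h : IsWeakDeriv f g) : ∃ f', Continuous f' ∧ f =ᵐ[volume] f' := by
  obtain ⟨c, hc⟩ := h.ae_eq_primitive
  exact ⟨_, continuous_const.add (continuous_primitive_of_locallyIntegrable h.2.1), hc⟩

lemma hasDerivAt (h : IsWeakDeriv f g) (hf : Continuous f) (hg : Continuous g')
    (hgg : g =ᵐ[volume] g') (x : ℝ) : HasDerivAt f (g' x) x := by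
  have heq : f = fun y => f 0 + ∫ s in (0 : ℝ)..y, g' s := by
    ext y
    rw [← intervalIntegral.integral_congr_ae (f := g) (hgg.mono fun x hx _ => hx),
      ← h.sub_eq_integral hf, add_sub_cancel]
  rw [heq]
  exact (hg.integral_hasStrictDerivAt 0 x).hasDerivAt.const_add _

lemma of_hasDerivAt (h : ∀ x, HasDerivAt f (g x) x) (hg : Continuous g) : IsWeakDeriv f g := by
  have hf : LocallyIntegrable f :=
    (continuous_iff_continuousAt.2 fun x => (h x).continuousAt).locallyIntegrable
  have hg := hg.locallyIntegrable (μ := volume)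
  refine isWeakDeriv_iff_integral_smul.2 ⟨hf, hg, fun ζ hζ hc => ?_⟩
  have hparts := integral_bilinear_hasDerivAt_right_eq_neg_left_of_integrable
    (L := ContinuousLinearMap.lsmul ℝ ℝ)
    (fun x _ => ((hζ.differentiable (by simp)) x).hasDerivAt) (fun x _ => h x)
    (hg.integrable_smul_left_of_hasCompactSupport hζ.continuous hc)
    (hf.integrable_smul_left_of_hasCompactSupport (continuous_deriv_of_contDiff_infty hζ) hc.deriv)
    (hf.integrable_smul_left_of_hasCompactSupport hζ.continuous hc)
  exact (neg_eq_iff_eq_neg.1 hparts.symm)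

lemma sub (h : IsWeakDeriv f g) (h' : IsWeakDeriv f' g') : IsWeakDeriv (f - f') (g - g') := by
  obtain ⟨hf, hg, H⟩ := isWeakDeriv_iff_integral_smul.1 h
  obtain ⟨hf', hg', H'⟩ := isWeakDeriv_iff_integral_smul.1 h'
  refine isWeakDeriv_iff_integral_smul.2 ⟨hf.sub hf', hg.sub hg', fun ζ hζ hc => ?_⟩
  have hζ' := continuous_deriv_of_contDiff_infty hζ
  simp only [Pi.sub_apply, smul_sub]
  rw [integral_sub (hf.integrable_smul_left_of_hasCompactSupport hζ' hc.deriv)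
      (hf'.integrable_smul_left_of_hasCompactSupport hζ' hc.deriv),
    integral_sub (hg.integrable_smul_left_of_hasCompactSupport hζ.continuous hc)
      (hg'.integrable_smul_left_of_hasCompactSupport hζ.continuous hc), H ζ hζ hc, H' ζ hζ hc,
    neg_sub_neg, neg_sub]

lemma neg (h : IsWeakDeriv f g) : IsWeakDeriv (-f) (-g) := by
  have hzero : IsWeakDeriv 0 0 := of_hasDerivAt (fun x => hasDerivAt_const x 0) continuous_const
  simpa only [zero_sub] using hzero.sub h

end IsWeakDeriv

/-! ### The embedding of `H¹(ℝ)` into `C₀(ℝ)` -/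

section Embedding

variable {E : Type*} [NormedAddCommGroup E] [NormedSpace ℝ E] {p : ENNReal} {f g : ℝ → E}

lemma tendsto_eLpNorm_restrict_Ioc_cocompact (hp : p ≠ ⊤) (hf : MemLp f p) :
    Tendsto (fun x : ℝ => eLpNorm f p (volume.restrict (Set.Ioc x (x + 1)))) (cocompact ℝ)
      (𝓝 0) := by
  refine ENNReal.tendsto_nhds_zero.2 fun ε hε => ?_
  obtain ⟨g, hg, hgε, -⟩ := hf.exists_hasCompactSupport_eLpNorm_sub_le hp (ε := ε) hε.ne'
  obtain ⟨R, -, hR⟩ := exists_tsupport_subset_Ioo hg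
  filter_upwards [tendsto_norm_cocompact_atTop.eventually_gt_atTop (R + 1)] with x hx
  have hgx : ∀ y ∈ Set.Ioc x (x + 1), f y = (f - g) y := fun y hy => by
    have hy' : y ∉ tsupport g := fun h => by
      obtain ⟨hleft, hright⟩ := hR h
      exact lt_asymm hx (abs_lt.2 ⟨by linarith [hy.2], by linarith [hy.1]⟩)
    rw [Pi.sub_apply, image_eq_zero_of_notMem_tsupport hy', sub_zero]
  rw [eLpNorm_congr_ae ((ae_restrict_iff' measurableSet_Ioc).2 (ae_of_all _ hgx))]
  exact (eLpNorm_restrict_le _ _ _ _).trans hgε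

lemma enorm_le_eLpNorm_restrict_add (hp : 1 ≤ p) (hf : AEStronglyMeasurable f)
    (hg : AEStronglyMeasurable g) (h : ∀ x y, f y - f x = ∫ s in x..y, g s) (x : ℝ) :
    ‖f x‖ₑ ≤ eLpNorm f p (volume.restrict (Set.Ioc x (x + 1)))
      + eLpNorm g p (volume.restrict (Set.Ioc x (x + 1))) := by
  set μ := volume.restrict (Set.Ioc x (x + 1)) with hμ
  have : IsProbabilityMeasure μ := ⟨by simp [hμ]⟩
  have hpointwise : ∀ y ∈ Set.Ioc x (x + 1), ‖f x‖ₑ ≤ ‖f y‖ₑ + eLpNorm g 1 μ := fun y hy =>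
    calc ‖f x‖ₑ = ‖f y - ∫ s in x..y, g s‖ₑ := by rw [← h x y, sub_sub_cancel]
      _ ≤ ‖f y‖ₑ + ‖∫ s in x..y, g s‖ₑ := enorm_sub_le
      _ ≤ ‖f y‖ₑ + eLpNorm g 1 μ := by
        gcongr
        rw [intervalIntegral.integral_of_le hy.1.le, eLpNorm_one_eq_lintegral_enorm]
        exact (enorm_integral_le_lintegral_enorm _).trans
          (lintegral_mono' (Measure.restrict_mono (Set.Ioc_subset_Ioc_right hy.2) le_rfl) le_rfl)
  calc ‖f x‖ₑ = ∫⁻ _, ‖f x‖ₑ ∂μ := by simp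
    _ ≤ ∫⁻ y, (‖f y‖ₑ + eLpNorm g 1 μ) ∂μ :=
      setLIntegral_mono_ae' measurableSet_Ioc (ae_of_all _ hpointwise)
    _ = eLpNorm f 1 μ + eLpNorm g 1 μ := by
      rw [lintegral_add_right _ measurable_const, eLpNorm_one_eq_lintegral_enorm (f := f)]
      simp
    _ ≤ eLpNorm f p μ + eLpNorm g p μ :=
      add_le_add (eLpNorm_le_eLpNorm_of_exponent_le hp hf.restrict)
        (eLpNorm_le_eLpNorm_of_exponent_le hp hg.restrict)

lemma enorm_le_eLpNorm_add (hp : 1 ≤ p) (hf : AEStronglyMeasurable f)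
    (hg : AEStronglyMeasurable g) (h : ∀ x y, f y - f x = ∫ s in x..y, g s) (x : ℝ) :
    ‖f x‖ₑ ≤ eLpNorm f p + eLpNorm g p :=
  (enorm_le_eLpNorm_restrict_add hp hf hg h x).trans
    (add_le_add (eLpNorm_restrict_le _ _ _ _) (eLpNorm_restrict_le _ _ _ _))

lemma tendsto_cocompact_zero_of_memLp (hp : 1 ≤ p) (hp' : p ≠ ⊤) (hf : MemLp f p)
    (hg : MemLp g p) (h : ∀ x y, f y - f x = ∫ s in x..y, g s) :
    Tendsto f (cocompact ℝ) (𝓝 0) := by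
  rw [tendsto_zero_iff_enorm_tendsto_zero]
  have hlim := (tendsto_eLpNorm_restrict_Ioc_cocompact hp' hf).add
    (tendsto_eLpNorm_restrict_Ioc_cocompact hp' hg)
  rw [add_zero] at hlim
  exact tendsto_of_tendsto_of_tendsto_of_le_of_le tendsto_const_nhds hlim (fun _ => zero_le)
    (enorm_le_eLpNorm_restrict_add hp hf.1 hg.1 h)

end Embedding

/-! ### Continuous curves in `C₀(ℝ)` and in `L²(ℝ)` -/

section Curves

variable {E : Type*} [NormedAddCommGroup E]

/-- `t ↦ f t` is a continuous curve in `C₀(ℝ)`. -/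
structure ContinuousInC0 (f : ℝ → ℝ → E) : Prop where
  continuous : ∀ t, Continuous (f t)
  tendsto_zero : ∀ t, Tendsto (f t) (cocompact ℝ) (𝓝 0)
  uniform : ∀ t₀, TendstoUniformly f (f t₀) (𝓝 t₀)

/-- `t ↦ f t` is a continuous curve in `L²(ℝ)`. -/
structure ContinuousInL2 (f : ℝ → ℝ → E) : Prop where
  memLp : ∀ t, MemLp (f t) 2
  tendsto : ∀ t₀, Tendsto (fun t => eLpNorm (f t - f t₀) 2) (𝓝 t₀) (𝓝 0)

lemma ContinuousInL2.congr {f g : ℝ → ℝ → E} (hf : ContinuousInL2 f) (h : ∀ t, f t =ᵐ[volume] g t) :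
    ContinuousInL2 g :=
  ⟨fun t => (hf.memLp t).ae_eq (h t), fun t₀ => (hf.tendsto t₀).congr fun t =>
    eLpNorm_congr_ae ((h t).sub (h t₀))⟩

namespace ContinuousInC0

variable {f : ℝ → ℝ → E}

lemma tendsto_nhds_prod (hf : ContinuousInC0 f) {t₀ : ℝ} {l : Filter ℝ} {y : E}
    (h : Tendsto (f t₀) l (𝓝 y)) : Tendsto (Function.uncurry f) (𝓝 t₀ ×ˢ l) (𝓝 y) :=
  (h.comp tendsto_snd).congr_uniformity
    ((tendstoUniformly_iff_tendsto.1 (hf.uniform t₀)).mono_left (prod_mono le_rfl le_top))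

lemma continuous_uncurry (hf : ContinuousInC0 f) : Continuous (Function.uncurry f) :=
  continuous_iff_continuousAt.2 fun ⟨t, x⟩ => by
    rw [ContinuousAt, nhds_prod_eq]
    exact hf.tendsto_nhds_prod ((hf.continuous t).tendsto x)

lemma tendstoUniformlyOn_cocompact (hf : ContinuousInC0 f) {s : Set ℝ} (hs : IsCompact s) :
    TendstoUniformlyOn (fun x t => f t x) 0 (cocompact ℝ) s := by
  rw [Metric.tendstoUniformlyOn_iff]
  intro ε hε
  have hmem := hs.mem_nhdsSet_prod_of_forall fun t _ =>
    hf.tendsto_nhds_prod (hf.tendsto_zero t) (Metric.ball_mem_nhds 0 hε)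
  filter_upwards [(eventually_swap_iff.1 hmem).curry] with x hx t ht
  simpa [dist_comm] using (hx.self_of_nhdsSet t ht)

lemma exists_norm_le (hf : ContinuousInC0 f) {s : Set ℝ} (hs : IsCompact s) :
    ∃ K, 0 ≤ K ∧ ∀ t ∈ s, ∀ x, ‖f t x‖ ≤ K := by
  have hfar := Metric.tendstoUniformlyOn_iff.1 (hf.tendstoUniformlyOn_cocompact hs) 1 one_pos
  obtain ⟨S, hS, hSc⟩ := mem_cocompact.1 hfar
  obtain ⟨K, hK⟩ := (hs.prod hS).exists_bound_of_continuousOn hf.continuous_uncurry.continuousOn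
  refine ⟨max K 1, le_max_of_le_right zero_le_one, fun t ht x => ?_⟩
  by_cases hx : x ∈ S
  · exact (hK (t, x) ⟨ht, hx⟩).trans (le_max_left _ _)
  · have := hSc hx t ht
    rw [Pi.zero_apply, dist_zero_left] at this
    exact this.le.trans (le_max_right _ _)

lemma of_continuousInL2 [NormedSpace ℝ E] {g : ℝ → ℝ → E} (hf : ContinuousInL2 f)
    (hg : ContinuousInL2 g) (hc : ∀ t, Continuous (f t))
    (h : ∀ t x y, f t y - f t x = ∫ s in x..y, g t s) : ContinuousInC0 f where
  continuous := hc
  tendsto_zero t := tendsto_cocompact_zero_of_memLp one_le_two (by norm_num) (hf.memLp t)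
    (hg.memLp t) (h t)
  uniform t₀ := by
    rw [Metric.tendstoUniformly_iff]
    intro ε hε
    have hlim := (hf.tendsto t₀).add (hg.tendsto t₀)
    rw [add_zero] at hlim
    filter_upwards [hlim.eventually (gt_mem_nhds (ENNReal.ofReal_pos.2 hε))] with t ht x
    have hi : ∀ t a b, IntervalIntegrable (g t) volume a b := fun t =>
      intervalIntegrable_of_locallyIntegrable ((hg.memLp t).locallyIntegrable one_le_two)
    have hdiff : ∀ x y, (f t - f t₀) y - (f t - f t₀) x = ∫ s in x..y, (g t - g t₀) s :=
      fun x y => by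
        simp only [Pi.sub_apply]
        rw [intervalIntegral.integral_sub (hi t x y) (hi t₀ x y), ← h, ← h, sub_sub_sub_comm]
    have hle := enorm_le_eLpNorm_add one_le_two ((hf.memLp t).1.sub (hf.memLp t₀).1)
      ((hg.memLp t).1.sub (hg.memLp t₀).1) hdiff x
    have hlt := hle.trans_lt ht
    rwa [← ofReal_norm, ENNReal.ofReal_lt_ofReal_iff hε, Pi.sub_apply, ← dist_eq_norm,
      dist_comm] at hlt

end ContinuousInC0

end Curves

/-! ### Classical regularity of solutions -/

/-- A solution `q` of (NLS) together with its derivatives `q'` and `q''` in `x`, all three being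
continuous curves in `C₀(ℝ)` and in `L²(ℝ)`. This is how membership in `C(ℝ; H³(ℝ))` is used; the
third derivative enters only to show that the Bäcklund transform is of the same class. -/
structure RegularSolution (q q' q'' : ℝ → ℝ → ℂ) : Prop where
  hasDerivAt : ∀ t x, HasDerivAt (q t) (q' t x) x
  hasDerivAt' : ∀ t x, HasDerivAt (q' t) (q'' t x) x
  c0 : ContinuousInC0 q
  c0' : ContinuousInC0 q'
  c0'' : ContinuousInC0 q''
  l2 : ContinuousInL2 q
  l2' : ContinuousInL2 q'
  l2'' : ContinuousInL2 q''
  time : ∀ t x, HasDerivAt (fun s => q s x)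
    (Complex.I * (q'' t x + 2 * (‖q t x‖ : ℂ) ^ 2 * q t x)) t

lemma IsH3SolutionNLS.exists_regularSolution {q : ℝ → ℝ → ℂ} (hq : IsH3SolutionNLS q) :
    ∃ q' q'' q₃ : ℝ → ℝ → ℂ, RegularSolution q q' q'' ∧ ContinuousInL2 q₃ ∧
      ∀ t, IsWeakDeriv (q'' t) (q₃ t) := by
  obtain ⟨hc, D, rfl, hw, hm, ht⟩ := hq.continuousInSobolev
  choose q' hq'c hq' using fun t => (hw 1 (by norm_num) t).exists_continuous
  choose q'' hq''c hq'' using fun t => (hw 2 (by norm_num) t).exists_continuous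
  have hD : ∀ k ≤ 3, ContinuousInL2 (D k) := fun k hk => ⟨hm k hk, ht k hk⟩
  have w₀ := hw 0 (by norm_num)
  have w₁ := fun t => (hw 1 (by norm_num) t).congr_left (hq' t)
  have w₂ := fun t => (hw 2 (by norm_num) t).congr_left (hq'' t)
  have d₀ : ∀ t x, HasDerivAt (D 0 t) (q' t x) x := fun t =>
    (w₀ t).hasDerivAt (hc t) (hq'c t) (hq' t)
  have d₁ : ∀ t x, HasDerivAt (q' t) (q'' t x) x := fun t =>
    (w₁ t).hasDerivAt (hq'c t) (hq''c t) (hq'' t)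
  have l₁ := (hD 1 (by norm_num)).congr hq'
  have l₂ := (hD 2 (by norm_num)).congr hq''
  have hequation : ∀ t x, deriv (fun s => D 0 s x) t
      = Complex.I * (q'' t x + 2 * (‖D 0 t x‖ : ℂ) ^ 2 * D 0 t x) := fun t x => by
    have hqt := hq.equation t x
    rw [show deriv (D 0 t) = q' t from funext fun x => (d₀ t x).deriv, (d₁ t x).deriv] at hqt
    linear_combination (-Complex.I) * hqt + (deriv (fun s => D 0 s x) t) * Complex.I_sq
  refine ⟨q', q'', D 3, ?_, hD 3 le_rfl, w₂⟩
  exact {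
    hasDerivAt := d₀
    hasDerivAt' := d₁
    c0 := .of_continuousInL2 (hD 0 (by norm_num)) (hD 1 (by norm_num)) hc
      fun t => (w₀ t).sub_eq_integral (hc t)
    c0' := .of_continuousInL2 l₁ (hD 2 (by norm_num)) hq'c fun t => (w₁ t).sub_eq_integral (hq'c t)
    c0'' := .of_continuousInL2 l₂ (hD 3 le_rfl) hq''c fun t => (w₂ t).sub_eq_integral (hq''c t)
    l2 := hD 0 (by norm_num)
    l2' := l₁
    l2'' := l₂
    time := fun t x => hequation t x ▸ (hq.differentiableAt_time t x).hasDerivAt }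

/-! ### Conservation of mass -/

lemma hasDerivAt_intervalIntegral_of_continuous {E : Type*} [NormedAddCommGroup E]
    [NormedSpace ℝ E] {F F' : ℝ → ℝ → E} (hF : ∀ s, Continuous (F s))
    (hF' : Continuous (Function.uncurry F')) (h : ∀ s x, HasDerivAt (fun s => F s x) (F' s x) s)
    (a b t : ℝ) : HasDerivAt (fun s => ∫ x in a..b, F s x) (∫ x in a..b, F' t x) t := by
  obtain ⟨K, hK⟩ := ((isCompact_closedBall t 1).prod
    (isCompact_uIcc (a := a) (b := b))).exists_bound_of_continuousOn hF'.continuousOn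
  refine (intervalIntegral.hasDerivAt_integral_of_dominated_loc_of_deriv_le (F := F)
    (bound := fun _ => K) (Metric.ball_mem_nhds t one_pos)
    (Eventually.of_forall fun s => (hF s).aestronglyMeasurable) ((hF t).intervalIntegrable _ _)
    (hF'.comp (by fun_prop : Continuous fun x => (t, x))).aestronglyMeasurable
    (ae_of_all _ fun x hx s hs => ?_) intervalIntegrable_const
    (ae_of_all _ fun x _ s _ => h s x)).2
  exact hK (s, x) ⟨Metric.ball_subset_closedBall hs, Set.uIoc_subset_uIcc hx⟩

namespace RegularSolution

variable {q q' q'' : ℝ → ℝ → ℂ}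

/-- The mass flux `i (q' q̄ - q q̄')`, whose `x`-derivative is `∂ₜ|q|²`. -/
def massFlux (q q' : ℝ → ℝ → ℂ) (t x : ℝ) : ℂ :=
  Complex.I * (q' t x * conj (q t x) - q t x * conj (q' t x))

lemma hasDerivAt_integral_mul_conj (hq : RegularSolution q q' q'') (a b t : ℝ) :
    HasDerivAt (fun s => ∫ x in a..b, q s x * conj (q s x))
      (massFlux q q' t b - massFlux q q' t a) t := by
  have hc := hq.c0.continuous_uncurry
  have hc'' := hq.c0''.continuous_uncurry
  have hF' : Continuous (Function.uncurry fun s x =>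
      Complex.I * (q'' s x * conj (q s x) - q s x * conj (q'' s x))) := by
    unfold Function.uncurry at *
    fun_prop
  have htime : ∀ s x, HasDerivAt (fun s => q s x * conj (q s x))
      (Complex.I * (q'' s x * conj (q s x) - q s x * conj (q'' s x))) s := fun s x => by
    refine ((hq.time s x).mul (hq.time s x).star).congr_deriv ?_
    simp only [← starRingEnd_apply, map_mul, map_add, Complex.conj_I, Complex.conj_ofReal, map_pow,
      map_ofNat]
    ring
  have hspace : ∀ x, HasDerivAt (massFlux q q' t)
      (Complex.I * (q'' t x * conj (q t x) - q t x * conj (q'' t x))) x := fun x =>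
    ((((hq.hasDerivAt' t x).mul (hq.hasDerivAt t x).star).sub
      ((hq.hasDerivAt t x).mul (hq.hasDerivAt' t x).star)).const_mul Complex.I).congr_deriv
        (by simp only [← starRingEnd_apply]; ring)
  have hF : ∀ s, Continuous fun x => q s x * conj (q s x) := fun s => by
    have := hq.c0.continuous s
    fun_prop
  refine (hasDerivAt_intervalIntegral_of_continuous hF hF' htime a b t).congr_deriv ?_
  exact intervalIntegral.integral_eq_sub_of_hasDerivAt (fun x _ => hspace x)
    ((hF'.comp (by fun_prop : Continuous fun x => (t, x))).intervalIntegrable _ _)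

lemma tendsto_integral_mul_conj (hq : RegularSolution q q' q'') (t : ℝ) :
    Tendsto (fun R : ℝ => ∫ x in (-R)..R, q t x * conj (q t x)) atTop
      (𝓝 ((∫ x, ‖q t x‖ ^ 2 : ℝ) : ℂ)) := by
  have heq : ∀ x, q t x * conj (q t x) = ((‖q t x‖ ^ 2 : ℝ) : ℂ) := fun x => by
    rw [Complex.mul_conj', Complex.ofReal_pow]
  simp only [heq, ← integral_complex_ofReal]
  exact intervalIntegral_tendsto_integral ((hq.l2.memLp t).integrable_norm_pow (by norm_num)).ofReal
    tendsto_neg_atTop_atBot tendsto_id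

lemma tendstoUniformlyOn_massFlux (hq : RegularSolution q q' q'') {s : Set ℝ} (hs : IsCompact s) :
    TendstoUniformlyOn (fun x t => massFlux q q' t x) 0 (cocompact ℝ) s := by
  rw [Metric.tendstoUniformlyOn_iff]
  intro ε hε
  have h0 := Metric.tendstoUniformlyOn_iff.1 (hq.c0.tendstoUniformlyOn_cocompact hs)
  have h1 := Metric.tendstoUniformlyOn_iff.1 (hq.c0'.tendstoUniformlyOn_cocompact hs)
  filter_upwards [h0 (ε / 2) (by positivity), h1 1 one_pos] with x hx hx' t ht
  have hqt := hx t ht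
  have hqt' := hx' t ht
  simp only [Pi.zero_apply, dist_zero_left] at hqt hqt' ⊢
  calc ‖massFlux q q' t x‖ ≤ ‖q' t x‖ * ‖q t x‖ + ‖q t x‖ * ‖q' t x‖ := by
        simpa only [massFlux, norm_mul, Complex.norm_I, one_mul, RCLike.norm_conj] using
          norm_sub_le (q' t x * conj (q t x)) (q t x * conj (q' t x))
    _ < ε := by nlinarith [norm_nonneg (q t x), norm_nonneg (q' t x)]

lemma integral_normSq_eq (hq : RegularSolution q q' q'') (t : ℝ) :
    ∫ x, ‖q t x‖ ^ 2 = ∫ x, ‖q 0 x‖ ^ 2 := by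
  have hflux : TendstoLocallyUniformlyOn
      (fun R t => massFlux q q' t R - massFlux q q' t (-R)) 0 atTop Set.univ := by
    refine (tendstoLocallyUniformlyOn_iff_forall_isCompact isOpen_univ).2 fun s _ hs => ?_
    have h := hq.tendstoUniformlyOn_massFlux hs
    have htop : TendstoUniformlyOn (fun R t => massFlux q q' t R) 0 atTop s :=
      fun u hu => atTop_le_cocompact (h u hu)
    have hbot : TendstoUniformlyOn (fun R t => massFlux q q' t (-R)) 0 atTop s :=
      fun u hu => (tendsto_neg_atTop_atBot.mono_right atBot_le_cocompact) (h u hu)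
    exact sub_zero (0 : ℝ → ℂ) ▸ htop.sub hbot
  have hderiv : ∀ t, HasDerivAt (fun t => ((∫ x, ‖q t x‖ ^ 2 : ℝ) : ℂ)) 0 t := fun t =>
    hasDerivAt_of_tendstoLocallyUniformlyOn isOpen_univ hflux
      (Eventually.of_forall fun R t _ => hq.hasDerivAt_integral_mul_conj (-R) R t)
      (fun t _ => hq.tendsto_integral_mul_conj t) (Set.mem_univ t)
  exact Complex.ofReal_injective
    (is_const_of_deriv_eq_zero (fun t => (hderiv t).differentiableAt) (fun t => (hderiv t).deriv)
      t 0)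

end RegularSolution

/-! ### A damped linear system with square integrable coefficient -/

lemma intervalIntegral_norm_mul_norm_le {E F : Type*} [NormedAddCommGroup E]
    [NormedAddCommGroup F] {f : ℝ → E} {g : ℝ → F} (hf : Continuous f) (hg : Continuous g)
    {a b : ℝ} (hab : a ≤ b) :
    ∫ x in a..b, ‖f x‖ * ‖g x‖ ≤ √(∫ x in a..b, ‖f x‖ ^ 2) * √(∫ x in a..b, ‖g x‖ ^ 2) := by
  have hL2 : ∀ h : ℝ → ℝ, Continuous h →
      MemLp h (ENNReal.ofReal 2) (volume.restrict (Set.Ioc a b)) := fun h hh => by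
    rw [ENNReal.ofReal_ofNat, memLp_two_iff_integrable_sq hh.aestronglyMeasurable]
    exact (intervalIntegrable_iff_integrableOn_Ioc_of_le hab).1 ((hh.pow 2).intervalIntegrable a b)
  have hholder := integral_mul_le_Lp_mul_Lq_of_nonneg Real.HolderConjugate.two_two
    (ae_of_all _ fun x => norm_nonneg (f x)) (ae_of_all _ fun x => norm_nonneg (g x))
    (hL2 _ hf.norm) (hL2 _ hg.norm)
  simpa only [intervalIntegral.integral_of_le hab, Real.sqrt_eq_rpow, Real.rpow_ofNat] using hholder

/-- The linear system `m' = r v`, `v' = -r̄ m - v`. -/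
structure IsDampedPair (r m v : ℝ → ℂ) : Prop where
  fst : ∀ x, HasDerivAt m (r x * v x) x
  snd : ∀ x, HasDerivAt v (-conj (r x) * m x - v x) x

/-- `r` is continuous and square integrable, with `L²` norm at most `δ`. -/
structure HasL2Bound {E : Type*} [NormedAddCommGroup E] (r : ℝ → E) (δ : ℝ) : Prop where
  continuous : Continuous r
  nonneg : 0 ≤ δ
  memLp : MemLp r 2
  integral_le : ∫ x, ‖r x‖ ^ 2 ≤ δ ^ 2

namespace HasL2Bound

variable {E F : Type*} [NormedAddCommGroup E] [NormedAddCommGroup F] {r : ℝ → E} {δ : ℝ}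

lemma intervalIntegral_le (h : HasL2Bound r δ) {a b : ℝ} (hab : a ≤ b) :
    ∫ x in a..b, ‖r x‖ ^ 2 ≤ δ ^ 2 := by
  rw [intervalIntegral.integral_of_le hab]
  exact (setIntegral_le_integral (h.memLp.integrable_norm_pow (by norm_num))
    (ae_of_all _ fun x => by positivity)).trans h.integral_le

lemma of_intervalIntegral_le (hr : Continuous r) (hδ : 0 ≤ δ)
    (h : ∀ a b, a ≤ b → ∫ x in a..b, ‖r x‖ ^ 2 ≤ δ ^ 2) : HasL2Bound r δ := by
  have hc : Continuous fun x => ‖r x‖ ^ 2 := hr.norm.pow 2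
  have hint : Integrable fun x => ‖r x‖ ^ 2 := by
    refine integrable_of_intervalIntegral_norm_bounded (a := fun R : ℝ => -R) (b := id) (l := atTop)
      (δ ^ 2) (fun R => ?_) tendsto_neg_atTop_atBot tendsto_id ?_
    · exact (hc.locallyIntegrable.integrableOn_isCompact isCompact_Icc).mono_set
        Set.Ioc_subset_Icc_self
    · filter_upwards [eventually_ge_atTop 0] with R hR
      simpa only [norm_pow, norm_norm, id_eq] using h (-R) R (by linarith)
  refine ⟨hr, hδ, (memLp_two_iff_integrable_sq_norm hr.aestronglyMeasurable).2 hint, ?_⟩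
  refine le_of_tendsto
    (intervalIntegral_tendsto_integral hint tendsto_neg_atTop_atBot tendsto_id) ?_
  filter_upwards [eventually_ge_atTop 0] with R hR
  exact h (-R) R (by linarith)

lemma of_norm_eq_comp_neg (h : HasL2Bound r δ) {s : ℝ → F} (hs : Continuous s)
    (hsr : ∀ x, ‖s x‖ = ‖r (-x)‖) : HasL2Bound s δ where
  continuous := hs
  nonneg := h.nonneg
  memLp := (h.memLp.comp_measurePreserving (Measure.measurePreserving_neg volume)).of_le
    hs.aestronglyMeasurable (ae_of_all _ fun x => (hsr x).le)
  integral_le := by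
    simp only [hsr]
    exact (integral_neg_eq_self (fun x => ‖r x‖ ^ 2) volume).trans_le h.integral_le

lemma neg_conj_comp_neg {r : ℝ → ℂ} (h : HasL2Bound r δ) :
    HasL2Bound (fun x => -conj (r (-x))) δ :=
  h.of_norm_eq_comp_neg (Complex.continuous_conj.comp (h.continuous.comp continuous_neg)).neg
    fun x => by rw [norm_neg, RCLike.norm_conj]

end HasL2Bound

namespace IsDampedPair

variable {r m v : ℝ → ℂ} {δ : ℝ}

lemma continuous_fst (h : IsDampedPair r m v) : Continuous m :=
  continuous_iff_continuousAt.2 fun x => (h.fst x).continuousAt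

lemma continuous_snd (h : IsDampedPair r m v) : Continuous v :=
  continuous_iff_continuousAt.2 fun x => (h.snd x).continuousAt

/-- The damping gives `(|v|²)' = -2|v|² - 2 Re(r̄ m v̄) ≤ M²|r|² - |v|²`. -/
lemma intervalIntegral_normSq_snd_le (h : IsDampedPair r m v) (hr : HasL2Bound r δ) {A X M : ℝ}
    (hAX : A ≤ X) (hM : ∀ x, A ≤ x → x ≤ X → ‖m x‖ ≤ M) :
    ∫ x in A..X, ‖v x‖ ^ 2 ≤ ‖v A‖ ^ 2 + M ^ 2 * δ ^ 2 := by
  have hrc := hr.continuous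
  have hmc := h.continuous_fst
  have hvc := h.continuous_snd
  set D : ℝ → ℝ := fun x => 2 * inner ℝ (v x) (-conj (r x) * m x - v x)
  have hDc : Continuous D := by fun_prop
  have hDle : ∀ x ∈ Set.Icc A X, D x ≤ M ^ 2 * ‖r x‖ ^ 2 - ‖v x‖ ^ 2 := fun x hx => by
    have hcross : inner ℝ (v x) (-conj (r x) * m x) ≤ ‖v x‖ * (‖r x‖ * M) := by
      refine (real_inner_le_norm _ _).trans ?_
      rw [norm_mul, norm_neg, RCLike.norm_conj]
      have := hM x hx.1 hx.2
      gcongr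
    simp only [D, inner_sub_right, real_inner_self_eq_norm_sq]
    nlinarith [sq_nonneg (‖v x‖ - ‖r x‖ * M)]
  have hftc : ∫ x in A..X, D x = ‖v X‖ ^ 2 - ‖v A‖ ^ 2 :=
    intervalIntegral.integral_eq_sub_of_hasDerivAt (fun x _ => (h.snd x).norm_sq)
      (hDc.intervalIntegrable _ _)
  have hle : ∫ x in A..X, D x ≤ M ^ 2 * (∫ x in A..X, ‖r x‖ ^ 2) - ∫ x in A..X, ‖v x‖ ^ 2 := by
    rw [← intervalIntegral.integral_const_mul, ← intervalIntegral.integral_sub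
      (Continuous.intervalIntegrable (by fun_prop) _ _)
      (Continuous.intervalIntegrable (by fun_prop) _ _)]
    exact intervalIntegral.integral_mono_on hAX (hDc.intervalIntegrable _ _)
      (Continuous.intervalIntegrable (by fun_prop) _ _) hDle
  have := mul_le_mul_of_nonneg_left (hr.intervalIntegral_le hAX) (sq_nonneg M)
  nlinarith [sq_nonneg ‖v X‖]

lemma norm_fst_sub_le (h : IsDampedPair r m v) (hr : HasL2Bound r δ) {x X e : ℝ} (hx : x ≤ X)
    (he : 0 ≤ e) (hv : ∫ y in x..X, ‖v y‖ ^ 2 ≤ e ^ 2) : ‖m X - m x‖ ≤ δ * e := by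
  have hrc := hr.continuous
  have hvc := h.continuous_snd
  calc ‖m X - m x‖ = ‖∫ y in x..X, r y * v y‖ := by
        rw [intervalIntegral.integral_eq_sub_of_hasDerivAt (fun y _ => h.fst y)
          ((hrc.mul hvc).intervalIntegrable _ _)]
    _ ≤ ∫ y in x..X, ‖r y‖ * ‖v y‖ := by
        simpa only [norm_mul] using
          intervalIntegral.norm_integral_le_integral_norm (f := fun y => r y * v y) hx
    _ ≤ √(∫ y in x..X, ‖r y‖ ^ 2) * √(∫ y in x..X, ‖v y‖ ^ 2) :=
        intervalIntegral_norm_mul_norm_le hrc hvc hx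
    _ ≤ δ * e := mul_le_mul (Real.sqrt_le_iff.2 ⟨hr.nonneg, hr.intervalIntegral_le hx⟩)
        (Real.sqrt_le_iff.2 ⟨he, hv⟩) (Real.sqrt_nonneg _) hr.nonneg

lemma norm_fst_le_of_forall_norm_le (h : IsDampedPair r m v) (hr : HasL2Bound r δ) {A M : ℝ}
    {m₀ : ℂ} (hm : Tendsto m atTop (𝓝 m₀)) (hM : ∀ x, A ≤ x → ‖m x‖ ≤ M) {x : ℝ} (hx : A ≤ x) :
    ‖m x‖ ≤ ‖m₀‖ + δ * (‖v A‖ + δ * M) := by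
  have hM0 : 0 ≤ M := (norm_nonneg _).trans (hM A le_rfl)
  have hδ := hr.nonneg
  have hvc := h.continuous_snd
  refine ge_of_tendsto (hm.norm.add_const _) ?_
  filter_upwards [eventually_ge_atTop x] with X hX
  have henergy : ∫ y in x..X, ‖v y‖ ^ 2 ≤ (‖v A‖ + δ * M) ^ 2 := calc
    ∫ y in x..X, ‖v y‖ ^ 2 ≤ ∫ y in A..X, ‖v y‖ ^ 2 :=
      intervalIntegral.integral_mono_interval hx hX le_rfl (ae_of_all _ fun y => by positivity)
        (Continuous.intervalIntegrable (by fun_prop) _ _)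
    _ ≤ ‖v A‖ ^ 2 + M ^ 2 * δ ^ 2 :=
      h.intervalIntegral_normSq_snd_le hr (hx.trans hX) fun y hy _ => hM y hy
    _ ≤ (‖v A‖ + δ * M) ^ 2 := by nlinarith [mul_nonneg (norm_nonneg (v A)) (mul_nonneg hδ hM0)]
  have hincrement := h.norm_fst_sub_le hr hX (by positivity) henergy
  linarith [norm_le_norm_add_norm_sub (m X) (m x)]

lemma norm_fst_le (h : IsDampedPair r m v) (hr : HasL2Bound r δ) (hδ : δ ^ 2 ≤ 1 / 2) {m₀ : ℂ}
    (hm : Tendsto m atTop (𝓝 m₀)) (x : ℝ) : ‖m x‖ ≤ 2 * (‖m₀‖ + δ * ‖v x‖) := by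
  have hbdd : BddAbove ((fun y => ‖m y‖) '' Set.Ici x) := by
    obtain ⟨B, hB⟩ := eventually_atTop.1 (hm.norm.eventually_le_const (lt_add_one ‖m₀‖))
    obtain ⟨C, hC⟩ := (isCompact_Icc (a := x) (b := B)).exists_bound_of_continuousOn
      h.continuous_fst.continuousOn
    refine ⟨max C (‖m₀‖ + 1), Set.forall_mem_image.2 fun y hy => ?_⟩
    rcases le_total B y with hBy | hyB
    · exact (hB y hBy).trans (le_max_right _ _)
    · exact (hC y ⟨hy, hyB⟩).trans (le_max_left _ _)
  set M := sSup ((fun y => ‖m y‖) '' Set.Ici x)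
  have hM : ∀ y, x ≤ y → ‖m y‖ ≤ M := fun y hy => le_csSup hbdd ⟨y, hy, rfl⟩
  have hself : M ≤ ‖m₀‖ + δ * (‖v x‖ + δ * M) :=
    csSup_le (Set.nonempty_Ici.image _) <| Set.forall_mem_image.2 fun y hy =>
      h.norm_fst_le_of_forall_norm_le hr hm hM hy
  nlinarith [hM x le_rfl, (norm_nonneg _).trans (hM x le_rfl)]

end IsDampedPair

/-! ### Bounds for the Jost functions -/

namespace IsJostPhi

variable {q φ₁ φ₂ : ℝ → ℂ} {δ : ℝ}

lemma isDampedPair (h : IsJostPhi q φ₁ φ₂) : IsDampedPair q φ₁ φ₂ :=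
  ⟨h.hasDerivAt_fst, h.hasDerivAt_snd⟩

/-- The factor `e^{-x}` and the reflection turn the condition at `-∞` into one at `+∞`. -/
lemma isDampedPair_reflect (h : IsJostPhi q φ₁ φ₂) :
    IsDampedPair (fun x => -conj (q (-x))) (fun x => (Real.exp (-x) : ℂ) * φ₂ (-x))
      (fun x => -((Real.exp (-x) : ℂ) * φ₁ (-x))) := by
  have hexp : ∀ x : ℝ, HasDerivAt (fun x : ℝ => (Real.exp (-x) : ℂ)) (-(Real.exp (-x) : ℂ)) x :=
    fun x => by simpa using (hasDerivAt_neg x).exp.ofReal_comp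
  constructor <;> intro x
  · refine ((hexp x).mul ((h.hasDerivAt_snd (-x)).scomp x (hasDerivAt_neg x))).congr_deriv ?_
    simp only [Function.comp, neg_smul, one_smul]
    ring
  · refine ((hexp x).mul ((h.hasDerivAt_fst (-x)).scomp x (hasDerivAt_neg x))).neg.congr_deriv ?_
    simp only [Function.comp, neg_smul, one_smul, map_neg, Complex.conj_conj]
    ring

lemma norm_snd_le_norm_fst (h : IsJostPhi q φ₁ φ₂) (hq : HasL2Bound q δ) (hδ : δ ^ 2 ≤ 1 / 2)
    (x : ℝ) : ‖φ₂ x‖ ≤ 2 * (δ * ‖φ₁ x‖) := by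
  have hlim : Tendsto (fun y : ℝ => (Real.exp (-y) : ℂ) * φ₂ (-y)) atTop (𝓝 0) :=
    h.tendsto_snd.comp tendsto_neg_atTop_atBot
  have hle := h.isDampedPair_reflect.norm_fst_le hq.neg_conj_comp_neg hδ hlim (-x)
  simp only [neg_neg, norm_neg, norm_mul, norm_zero, zero_add] at hle
  have hpos : 0 < ‖(Real.exp x : ℂ)‖ := norm_pos_iff.2 (by exact_mod_cast (Real.exp_pos x).ne')
  refine le_of_mul_le_mul_left ?_ hpos
  linarith

lemma norm_fst_le (h : IsJostPhi q φ₁ φ₂) (hq : HasL2Bound q δ) (hδ : δ ^ 2 ≤ 1 / 8) (x : ℝ) :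
    ‖φ₁ x‖ ≤ 4 := by
  have hfst := h.isDampedPair.norm_fst_le hq (by linarith) h.tendsto_fst x
  have hsnd := mul_le_mul_of_nonneg_left (h.norm_snd_le_norm_fst hq (by linarith) x) hq.nonneg
  rw [norm_one] at hfst
  nlinarith [mul_le_mul_of_nonneg_right hδ (norm_nonneg (φ₁ x))]

lemma norm_snd_le (h : IsJostPhi q φ₁ φ₂) (hq : HasL2Bound q δ) (hδ : δ ^ 2 ≤ 1 / 8) (x : ℝ) :
    ‖φ₂ x‖ ≤ 8 * δ := by
  have hfst := mul_le_mul_of_nonneg_left (h.norm_fst_le hq hδ x) hq.nonneg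
  linarith [h.norm_snd_le_norm_fst hq (by linarith) x]

lemma hasL2Bound_snd (h : IsJostPhi q φ₁ φ₂) (hq : HasL2Bound q δ) (hδ : δ ^ 2 ≤ 1 / 8) :
    HasL2Bound φ₂ (9 * δ) := by
  refine .of_intervalIntegral_le h.isDampedPair.continuous_snd (by linarith [hq.nonneg])
    fun a b hab => ?_
  have henergy := h.isDampedPair.intervalIntegral_normSq_snd_le hq hab (M := 4)
    fun x _ _ => h.norm_fst_le hq hδ x
  have hsnd := pow_le_pow_left₀ (norm_nonneg _) (h.norm_snd_le hq hδ a) 2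
  nlinarith [sq_nonneg δ]

lemma norm_fst_sub_one_le (h : IsJostPhi q φ₁ φ₂) (hq : HasL2Bound q δ) (hδ : δ ^ 2 ≤ 1 / 8)
    (x : ℝ) : ‖φ₁ x - 1‖ ≤ 9 * δ ^ 2 := by
  have hφ₂ := h.hasL2Bound_snd hq hδ
  rw [norm_sub_rev]
  refine le_of_tendsto (h.tendsto_fst.sub_const _).norm ?_
  filter_upwards [eventually_ge_atTop x] with X hX
  exact (h.isDampedPair.norm_fst_sub_le hq hX hφ₂.nonneg (hφ₂.intervalIntegral_le hX)).trans_eq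
    (by ring)

lemma tendsto_snd_atTop (h : IsJostPhi q φ₁ φ₂) (hq : HasL2Bound q δ) (hδ : δ ^ 2 ≤ 1 / 8) :
    Tendsto φ₂ atTop (𝓝 0) := by
  have hφ₁c := h.isDampedPair.continuous_fst
  have hφ₂ := h.hasL2Bound_snd hq hδ
  have hφ₂c := hφ₂.continuous
  have hqc := hq.continuous
  have hqφ₁ : MemLp (fun x => -conj (q x) * φ₁ x) 2 := by
    refine hq.memLp.of_le_mul (c := 4) (by fun_prop : Continuous _).aestronglyMeasurable
      (ae_of_all _ fun x => ?_)
    rw [norm_mul, norm_neg, RCLike.norm_conj, mul_comm]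
    exact mul_le_mul_of_nonneg_right (h.norm_fst_le hq hδ x) (norm_nonneg _)
  refine (tendsto_cocompact_zero_of_memLp one_le_two (by norm_num) hφ₂.memLp
    (hqφ₁.sub hφ₂.memLp) fun x y => ?_).mono_left atTop_le_cocompact
  exact (intervalIntegral.integral_eq_sub_of_hasDerivAt (fun z _ => h.hasDerivAt_snd z)
    (Continuous.intervalIntegrable (by fun_prop) _ _)).symm

end IsJostPhi

/-! ### The reflection symmetry -/

lemma IsJostChi.isJostPhi_reflect {q χ₁ χ₂ : ℝ → ℂ} (h : IsJostChi q χ₁ χ₂) :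
    IsJostPhi (fun x => -conj (q (-x))) (fun x => -χ₂ (-x)) (fun x => χ₁ (-x)) := by
  refine ⟨fun x => ?_, fun x => ?_, ?_, ?_⟩
  · refine ((h.hasDerivAt_snd (-x)).scomp x (hasDerivAt_neg x)).neg.congr_deriv ?_
    simp only [neg_smul, one_smul, neg_mul, neg_neg]
  · refine ((h.hasDerivAt_fst (-x)).scomp x (hasDerivAt_neg x)).congr_deriv ?_
    simp only [neg_smul, one_smul, map_neg, Complex.conj_conj]
    ring
  · simpa using (h.tendsto_snd.comp tendsto_neg_atTop_atBot).neg
  · simpa [Function.comp_def] using h.tendsto_fst.comp tendsto_neg_atBot_atTop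

lemma IsJostPhi.isJostChi_reflect {q φ₁ φ₂ : ℝ → ℂ} (h : IsJostPhi q φ₁ φ₂) :
    IsJostChi (fun x => -conj (q (-x))) (fun x => φ₂ (-x)) (fun x => -φ₁ (-x)) := by
  refine ⟨fun x => ?_, fun x => ?_, ?_, ?_⟩
  · refine ((h.hasDerivAt_snd (-x)).scomp x (hasDerivAt_neg x)).congr_deriv ?_
    simp only [neg_smul, one_smul]
    ring
  · refine ((h.hasDerivAt_fst (-x)).scomp x (hasDerivAt_neg x)).neg.congr_deriv ?_
    simp only [neg_smul, one_smul, map_neg, Complex.conj_conj]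
    ring
  · simpa [Function.comp_def] using h.tendsto_snd.comp tendsto_neg_atTop_atBot
  · exact (h.tendsto_fst.comp tendsto_neg_atBot_atTop).neg

/-! ### Continuous dependence for linear equations -/

section LinearODE

variable {E : Type*} [NormedAddCommGroup E] [NormedSpace ℝ E]

lemma norm_le_gronwallBound_of_hasDerivAt {f f' : ℝ → E} {a b K ε : ℝ}
    (hf : ∀ s, HasDerivAt f (f' s) s) (hle : ∀ s ∈ Set.uIcc a b, ‖f' s‖ ≤ K * ‖f s‖ + ε) :
    ‖f b‖ ≤ gronwallBound ‖f a‖ K ε |b - a| := by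
  have hforward : ∀ {g g' : ℝ → E} {a b : ℝ}, a ≤ b → (∀ s, HasDerivAt g (g' s) s) →
      (∀ s ∈ Set.Icc a b, ‖g' s‖ ≤ K * ‖g s‖ + ε) → ‖g b‖ ≤ gronwallBound ‖g a‖ K ε (b - a) :=
    fun hab hg hle => norm_le_gronwallBound_of_norm_deriv_right_le
      (fun s _ => (hg s).continuousAt.continuousWithinAt) (fun s _ => (hg s).hasDerivWithinAt)
      le_rfl (fun s hs => hle s (Set.Ico_subset_Icc_self hs)) _ (Set.right_mem_Icc.2 hab)
  rcases le_total a b with hab | hba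
  · rw [Set.uIcc_of_le hab] at hle
    simpa only [abs_of_nonneg (sub_nonneg.2 hab)] using hforward hab hf hle
  · rw [Set.uIcc_of_ge hba] at hle
    have hreflect := hforward (g := fun s => f (-s)) (g' := fun s => -f' (-s)) (neg_le_neg hba)
      (fun s => by
        simpa [Function.comp_def] using (hf (-s)).scomp s (hasDerivAt_neg s)) fun s hs => by
        simpa only [norm_neg] using hle (-s) ⟨by linarith [hs.2], by linarith [hs.1]⟩
    simpa only [neg_neg, abs_of_nonpos (sub_nonpos.2 hba), neg_sub, neg_sub_neg] using hreflect

lemma gronwallBound_le_add_mul_exp {δ K ε x : ℝ} (hK : 1 ≤ K) (hε : 0 ≤ ε) :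
    gronwallBound δ K ε x ≤ (δ + ε) * Real.exp (K * x) := by
  rw [gronwallBound_of_K_ne_0 (by positivity)]
  have hdiv : ε / K ≤ ε := div_le_self hε hK
  have hdiv0 : 0 ≤ ε / K := by positivity
  nlinarith [Real.exp_pos (K * x)]

lemma norm_sub_le_of_hasDerivAt_linear {A A₀ : ℝ → E →L[ℝ] E} {f f₀ u u₀ : ℝ → E} {a b K M η : ℝ}
    (hu : ∀ s, HasDerivAt u (A s (u s) + f s) s) (hu₀ : ∀ s, HasDerivAt u₀ (A₀ s (u₀ s) + f₀ s) s)
    (hK : 1 ≤ K) (hAK : ∀ s ∈ Set.uIcc a b, ‖A s‖ ≤ K) (hM : ∀ s ∈ Set.uIcc a b, ‖u₀ s‖ ≤ M)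
    (hA : ∀ s ∈ Set.uIcc a b, ‖A s - A₀ s‖ ≤ η) (hf : ∀ s ∈ Set.uIcc a b, ‖f s - f₀ s‖ ≤ η)
    (ha : ‖u a - u₀ a‖ ≤ η) : ‖u b - u₀ b‖ ≤ η * (M + 2) * Real.exp (K * |b - a|) := by
  have hη : 0 ≤ η := (norm_nonneg _).trans ha
  have hM0 : 0 ≤ M := (norm_nonneg _).trans (hM a Set.left_mem_uIcc)
  have hdiff : ∀ s, HasDerivAt (fun s => u s - u₀ s)
      (A s (u s - u₀ s) + ((A s - A₀ s) (u₀ s) + (f s - f₀ s))) s := fun s =>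
    ((hu s).sub (hu₀ s)).congr_deriv (by simp only [map_sub, sub_apply]; abel)
  have hle : ∀ s ∈ Set.uIcc a b, ‖A s (u s - u₀ s) + ((A s - A₀ s) (u₀ s) + (f s - f₀ s))‖
      ≤ K * ‖u s - u₀ s‖ + (η * M + η) := fun s hs =>
    (norm_add_le _ _).trans <| add_le_add (ContinuousLinearMap.le_of_opNorm_le _ (hAK s hs) _) <|
      (norm_add_le _ _).trans <|
        add_le_add (ContinuousLinearMap.le_of_opNorm_le_of_le _ (hA s hs) (hM s hs)) (hf s hs)
  calc ‖u b - u₀ b‖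
      ≤ (‖u a - u₀ a‖ + (η * M + η)) * Real.exp (K * |b - a|) :=
        (norm_le_gronwallBound_of_hasDerivAt hdiff hle).trans
          (gronwallBound_le_add_mul_exp hK (by positivity))
    _ ≤ η * (M + 2) * Real.exp (K * |b - a|) := by gcongr; linarith

lemma tendsto_of_hasDerivAt_linear {ι : Type*} {l : Filter ι} {A : ι → ℝ → E →L[ℝ] E}
    {A₀ : ℝ → E →L[ℝ] E} {f u : ι → ℝ → E} {f₀ u₀ : ℝ → E} {a b : ℝ}
    (hu : ∀ i s, HasDerivAt (u i) (A i s (u i s) + f i s) s)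
    (hu₀ : ∀ s, HasDerivAt u₀ (A₀ s (u₀ s) + f₀ s) s) (hA₀ : Continuous A₀)
    (hA : TendstoUniformlyOn A A₀ l (Set.uIcc a b))
    (hf : TendstoUniformlyOn f f₀ l (Set.uIcc a b))
    (ha : Tendsto (fun i => u i a) l (𝓝 (u₀ a))) : Tendsto (fun i => u i b) l (𝓝 (u₀ b)) := by
  have hu₀c : Continuous u₀ := continuous_iff_continuousAt.2 fun s => (hu₀ s).continuousAt
  obtain ⟨K, hK⟩ := (isCompact_uIcc (a := a) (b := b)).exists_bound_of_continuousOn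
    hA₀.continuousOn
  obtain ⟨M, hM⟩ := (isCompact_uIcc (a := a) (b := b)).exists_bound_of_continuousOn
    hu₀c.continuousOn
  have hK0 : 0 ≤ K := (norm_nonneg _).trans (hK a Set.left_mem_uIcc)
  have hM0 : 0 ≤ M := (norm_nonneg _).trans (hM a Set.left_mem_uIcc)
  set C := (M + 2) * Real.exp ((K + 1) * |b - a|)
  have hC0 : 0 < C := by positivity
  rw [Metric.tendsto_nhds]
  intro ε hε
  obtain ⟨η, hη, hη1, hηε⟩ : ∃ η > 0, η ≤ 1 ∧ η * C < ε := by
    refine ⟨min 1 (ε / (2 * C)), by positivity, min_le_left _ _, ?_⟩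
    calc min 1 (ε / (2 * C)) * C ≤ ε / (2 * C) * C := by gcongr; exact min_le_right _ _
      _ = ε / 2 := by field_simp
      _ < ε := half_lt_self hε
  filter_upwards [Metric.tendstoUniformlyOn_iff.1 hA η hη, Metric.tendstoUniformlyOn_iff.1 hf η hη,
    Metric.tendsto_nhds.1 ha η hη] with i hAi hfi hai
  have hAη : ∀ s ∈ Set.uIcc a b, ‖A i s - A₀ s‖ ≤ η := fun s hs =>
    (dist_eq_norm' (A₀ s) (A i s)).symm.trans_le (hAi s hs).le
  have hAK : ∀ s ∈ Set.uIcc a b, ‖A i s‖ ≤ K + 1 := fun s hs => by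
    linarith [norm_le_norm_add_norm_sub' (A i s) (A₀ s), hK s hs, hAη s hs]
  rw [dist_eq_norm]
  refine (norm_sub_le_of_hasDerivAt_linear (hu i) hu₀ (by linarith) hAK hM hAη (fun s hs =>
    (dist_eq_norm' (f₀ s) (f i s)).symm.trans_le (hfi s hs).le)
    (dist_eq_norm (u i a) (u₀ a) ▸ hai.le)).trans_lt ?_
  rwa [mul_assoc]

lemma tendstoUniformlyOn_of_continuous_uncurry {F : Type*} [PseudoMetricSpace F] {f : ℝ → ℝ → F}
    (hf : Continuous (Function.uncurry f)) (x : ℝ) {S : Set ℝ} (hS : IsCompact S) :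
    TendstoUniformlyOn (fun y s => f s y) (fun s => f s x) (𝓝 x) S := by
  have hswap : Continuous (Function.uncurry fun y s => f s y) := hf.comp continuous_swap
  rw [Metric.tendstoUniformlyOn_iff]
  intro ε hε
  obtain ⟨V, hV, hVε⟩ := hS.mem_uniformity_of_prod (s := Set.univ) hswap.continuousOn
    (Set.mem_univ x) (Metric.dist_mem_uniformity hε)
  rw [nhdsWithin_univ] at hV
  filter_upwards [hV] with y hy s hs
  rw [dist_comm]
  exact hVε y hy s hs

lemma tendstoUniformlyOn_slope {g g' : ℝ → ℝ → E} (hg : ∀ s y, HasDerivAt (g s) (g' s y) y)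
    (hg' : Continuous (Function.uncurry g')) (x : ℝ) {S : Set ℝ} (hS : IsCompact S) :
    TendstoUniformlyOn (fun y s => slope (g s) x y) (fun s => g' s x) (𝓝[≠] x) S := by
  rw [Metric.tendstoUniformlyOn_iff]
  intro ε hε
  obtain ⟨δ, hδ, hball⟩ := Metric.eventually_nhds_iff_ball.1 <|
    Metric.tendstoUniformlyOn_iff.1 (tendstoUniformlyOn_of_continuous_uncurry hg' x hS)
      (ε / 2) (half_pos hε)
  filter_upwards [self_mem_nhdsWithin, mem_nhdsWithin_of_mem_nhds (Metric.ball_mem_nhds x hδ)]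
    with y hyx hy s hs
  have hlinear : ∀ z, HasDerivAt (fun z => g s z - (z - x) • g' s x) (g' s z - g' s x) z :=
    fun z => ((hg s z).sub (((hasDerivAt_id z).sub_const x).smul_const (g' s x))).congr_deriv
      (by rw [one_smul])
  have hmean : ‖g s y - (y - x) • g' s x - (g s x - (x - x) • g' s x)‖ ≤ ε / 2 * ‖y - x‖ :=
    (convex_ball x δ).norm_image_sub_le_of_norm_hasDerivWithin_le
      (fun z _ => (hlinear z).hasDerivWithinAt)
      (fun z hz => (dist_eq_norm' (g' s x) (g' s z)).symm.trans_le (hball z hz s hs).le)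
      (Metric.mem_ball_self hδ) hy
  have hyx' : y - x ≠ 0 := sub_ne_zero.2 hyx
  have hslope : slope (g s) x y - g' s x
      = (y - x)⁻¹ • (g s y - (y - x) • g' s x - (g s x - (x - x) • g' s x)) := by
    rw [slope_def_module, sub_self, zero_smul, sub_zero, sub_right_comm, smul_sub _ _ (_ • _),
      inv_smul_smul₀ hyx']
  rw [dist_eq_norm', hslope, norm_smul, norm_inv, inv_mul_lt_iff₀ (norm_pos_iff.2 hyx')]
  linarith [mul_pos hε (norm_pos_iff.2 hyx')]

/-- The difference quotients of `v` in space solve the linear equation in time with coefficient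
`B s y` and a forcing that converges, so they converge for all times if they do at time `0`. -/
lemma hasDerivAt_space_of_hasDerivAt_time {B B' : ℝ → ℝ → E →L[ℝ] E}
    (hB : ∀ s y, HasDerivAt (B s) (B' s y) y) (hBc : Continuous (Function.uncurry B))
    (hB'c : Continuous (Function.uncurry B')) {v : ℝ → ℝ → E} {x : ℝ} {β : ℝ → E}
    (hv : ∀ s y, HasDerivAt (fun s => v s y) (B s y (v s y)) s)
    (hβ : ∀ s, HasDerivAt β (B s x (β s) + B' s x (v s x)) s) (h0 : HasDerivAt (v 0) (β 0) x)
    (t : ℝ) : HasDerivAt (v t) (β t) x := by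
  have hvc : Continuous fun s => v s x :=
    continuous_iff_continuousAt.2 fun s => (hv s x).continuousAt
  rw [hasDerivAt_iff_tendsto_slope] at h0 ⊢
  refine tendsto_of_hasDerivAt_linear (A := fun y s => B s y) (A₀ := fun s => B s x)
    (u := fun y s => slope (v s) x y) (f := fun y s => slope (fun y => B s y (v s x)) x y)
    (f₀ := fun s => B' s x (v s x)) (a := 0) (fun y s => ?_) hβ (hBc.comp (.prodMk_left x))
    ?_ ?_ h0
  · simp only [slope_def_module]
    refine (((hv s y).sub (hv s x)).const_smul (y - x)⁻¹).congr_deriv ?_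
    rw [map_smul, ← smul_add, map_sub, sub_add_sub_cancel]
  · exact fun U hU => mem_nhdsWithin_of_mem_nhds
      (tendstoUniformlyOn_of_continuous_uncurry hBc x isCompact_uIcc U hU)
  · refine tendstoUniformlyOn_slope (g' := fun s y => B' s y (v s x)) (fun s y => ?_)
      (hB'c.clm_apply (hvc.comp continuous_fst)) x isCompact_uIcc
    simpa using (hB s y).clm_apply (hasDerivAt_const y (v s x))

end LinearODE

/-! ### Evolution of the Jost solutions -/

lemma hasDerivAt_conj {f : ℝ → ℂ} {f' : ℂ} {x : ℝ} (h : HasDerivAt f f' x) :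
    HasDerivAt (fun y => conj (f y)) (conj f') x := h.star

/-- The trace-free matrix `[[a, b], [c, -a]]` as a real-linear map on `ℂ × ℂ`. -/
def traceFreeOp (a b c : ℂ) : ℂ × ℂ →L[ℝ] ℂ × ℂ :=
  a • (ContinuousLinearMap.fst ℝ ℂ ℂ).prod (-ContinuousLinearMap.snd ℝ ℂ ℂ)
    + b • (ContinuousLinearMap.snd ℝ ℂ ℂ).prod 0
    + c • (0 : ℂ × ℂ →L[ℝ] ℂ).prod (ContinuousLinearMap.fst ℝ ℂ ℂ)

lemma traceFreeOp_apply (a b c v₁ v₂ : ℂ) :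
    traceFreeOp a b c (v₁, v₂) = (a * v₁ + b * v₂, c * v₁ - a * v₂) := by
  simp only [traceFreeOp, smul_apply, add_apply, neg_apply, zero_apply,
    ContinuousLinearMap.prod_apply, ContinuousLinearMap.coe_fst', ContinuousLinearMap.coe_snd',
    Prod.smul_mk, Prod.mk_add_mk, smul_eq_mul, mul_zero, add_zero]
  congr 1
  ring

lemma continuous_traceFreeOp {X : Type*} [TopologicalSpace X] {a b c : X → ℂ} (ha : Continuous a)
    (hb : Continuous b) (hc : Continuous c) :
    Continuous fun x => traceFreeOp (a x) (b x) (c x) := by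
  unfold traceFreeOp
  fun_prop

lemma hasDerivAt_traceFreeOp {a b c : ℝ → ℂ} {a' b' c' : ℂ} {x : ℝ} (ha : HasDerivAt a a' x)
    (hb : HasDerivAt b b' x) (hc : HasDerivAt c c' x) :
    HasDerivAt (fun y => traceFreeOp (a y) (b y) (c y)) (traceFreeOp a' b' c') x :=
  ((ha.smul_const ((ContinuousLinearMap.fst ℝ ℂ ℂ).prod (-ContinuousLinearMap.snd ℝ ℂ ℂ))).add
    (hb.smul_const ((ContinuousLinearMap.snd ℝ ℂ ℂ).prod (0 : ℂ × ℂ →L[ℝ] ℂ)))).add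
    (hc.smul_const ((0 : ℂ × ℂ →L[ℝ] ℂ).prod (ContinuousLinearMap.fst ℝ ℂ ℂ)))

/-- The matrix `i [[1/2 + |u|², u' + u], [ū' - ū, -1/2 - |u|²]]` of the time equation of the Lax
pair, at a point where the potential has the value `u` and the derivative `u'`. -/
def laxTimeOp (u u' : ℂ) : ℂ × ℂ →L[ℝ] ℂ × ℂ :=
  traceFreeOp (Complex.I * (1 / 2 + u * conj u)) (Complex.I * (u' + u))
    (Complex.I * (conj u' - conj u))

lemma continuous_laxTimeOp {X : Type*} [TopologicalSpace X] {u u' : X → ℂ} (hu : Continuous u)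
    (hu' : Continuous u') : Continuous fun x => laxTimeOp (u x) (u' x) :=
  continuous_traceFreeOp (by fun_prop) (by fun_prop) (by fun_prop)

lemma tendsto_laxTimeOp {ι : Type*} {l : Filter ι} {u u' : ι → ℂ} {u₀ u₀' : ℂ}
    (hu : Tendsto u l (𝓝 u₀)) (hu' : Tendsto u' l (𝓝 u₀')) :
    Tendsto (fun i => laxTimeOp (u i) (u' i)) l (𝓝 (laxTimeOp u₀ u₀')) := by
  simpa only [Function.comp_def] using
    ((continuous_laxTimeOp continuous_fst continuous_snd).tendsto (u₀, u₀')).comp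
      (hu.prodMk_nhds hu')

lemma hasDerivAt_laxTimeOp {u u' : ℝ → ℂ} {u'' : ℂ} {x : ℝ} (hu : HasDerivAt u (u' x) x)
    (hu' : HasDerivAt u' u'' x) : HasDerivAt (fun y => laxTimeOp (u y) (u' y))
      (traceFreeOp (Complex.I * (u' x * conj (u x) + u x * conj (u' x)))
        (Complex.I * (u'' + u' x)) (Complex.I * (conj u'' - conj (u' x)))) x :=
  hasDerivAt_traceFreeOp (((hu.mul (hasDerivAt_conj hu)).const_add _).const_mul _)
    ((hu'.add hu).const_mul _) (((hasDerivAt_conj hu').sub (hasDerivAt_conj hu)).const_mul _)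

lemma ContinuousInC0.neg {f : ℝ → ℝ → ℂ} (hf : ContinuousInC0 f) :
    ContinuousInC0 fun t x => -f t x where
  continuous t := (hf.continuous t).neg
  tendsto_zero t := by simpa only [neg_zero] using (hf.tendsto_zero t).neg
  uniform t₀ := by
    simpa only [Metric.tendstoUniformly_iff, dist_neg_neg] using hf.uniform t₀

lemma ContinuousInC0.conj_reflect {f : ℝ → ℝ → ℂ} (hf : ContinuousInC0 f) :
    ContinuousInC0 fun t x => conj (f (-t) (-x)) where
  continuous t := Complex.continuous_conj.comp ((hf.continuous _).comp continuous_neg)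
  tendsto_zero t := by
    have hreflect : Tendsto (fun x : ℝ => f (-t) (-x)) (cocompact ℝ) (𝓝 0) :=
      (hf.tendsto_zero (-t)).comp (Homeomorph.neg ℝ).isClosedEmbedding.tendsto_cocompact
    simpa [Function.comp_def] using (Complex.continuous_conj.tendsto 0).comp hreflect
  uniform t₀ := by
    have hunif := Metric.tendstoUniformly_iff.1 (hf.uniform (-t₀))
    rw [Metric.tendstoUniformly_iff]
    intro ε hε
    filter_upwards [(continuous_neg.tendsto t₀).eventually (hunif ε hε)] with t ht x
    simpa only [Complex.dist_conj_conj] using ht (-x)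

lemma ContinuousInL2.neg {f : ℝ → ℝ → ℂ} (hf : ContinuousInL2 f) :
    ContinuousInL2 fun t x => -f t x where
  memLp t := (hf.memLp t).neg
  tendsto t₀ := (hf.tendsto t₀).congr fun t => by
    rw [← eLpNorm_neg]
    congr 1
    ext x
    simp only [Pi.neg_apply, Pi.sub_apply]
    ring

lemma ContinuousInL2.conj_reflect {f : ℝ → ℝ → ℂ} (hf : ContinuousInL2 f) :
    ContinuousInL2 fun t x => conj (f (-t) (-x)) where
  memLp t :=
    ((hf.memLp (-t)).comp_measurePreserving (Measure.measurePreserving_neg volume)).star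
  tendsto t₀ := ((hf.tendsto (-t₀)).comp (continuous_neg.tendsto t₀)).congr fun t => by
    rw [Function.comp_apply, ← eLpNorm_comp_measurePreserving
      ((hf.memLp (-t)).1.sub (hf.memLp (-t₀)).1) (Measure.measurePreserving_neg volume)]
    refine eLpNorm_congr_norm_ae (ae_of_all _ fun x => ?_)
    simp only [Function.comp, Pi.sub_apply, ← map_sub, RCLike.norm_conj]

namespace RegularSolution

variable {q q' q'' v₁ v₂ : ℝ → ℝ → ℂ}

lemma hasDerivAt_prodMk (hq : RegularSolution q q' q'') (h : SolvesLaxTime q v₁ v₂) (t x : ℝ) :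
    HasDerivAt (fun s => (v₁ s x, v₂ s x)) (laxTimeOp (q t x) (q' t x) (v₁ t x, v₂ t x)) t := by
  refine ((h.hasDerivAt_fst t x).prodMk (h.hasDerivAt_snd t x)).congr_deriv ?_
  rw [laxTimeOp, traceFreeOp_apply, (hq.hasDerivAt t x).deriv, Complex.mul_conj']
  congr 1 <;> ring

lemma hasDerivAt_space_of_solvesLaxTime (hq : RegularSolution q q' q'')
    (h : SolvesLaxTime q v₁ v₂) (h₁ : ∀ x, HasDerivAt (v₁ 0) (q 0 x * v₂ 0 x) x)
    (h₂ : ∀ x, HasDerivAt (v₂ 0) (-conj (q 0 x) * v₁ 0 x - v₂ 0 x) x) (t x : ℝ) :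
    HasDerivAt (v₁ t) (q t x * v₂ t x) x ∧
      HasDerivAt (v₂ t) (-conj (q t x) * v₁ t x - v₂ t x) x := by
  have hc := hq.c0.continuous_uncurry
  have hc' := hq.c0'.continuous_uncurry
  have hc'' := hq.c0''.continuous_uncurry
  have hcoeff : Continuous (Function.uncurry fun s y =>
      traceFreeOp (Complex.I * (q' s y * conj (q s y) + q s y * conj (q' s y)))
        (Complex.I * (q'' s y + q' s y)) (Complex.I * (conj (q'' s y) - conj (q' s y)))) := by
    unfold Function.uncurry at hc hc' hc'' ⊢
    exact continuous_traceFreeOp (by fun_prop) (by fun_prop) (by fun_prop)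
  have hpair : HasDerivAt (fun y => (v₁ t y, v₂ t y))
      (q t x * v₂ t x, -conj (q t x) * v₁ t x - v₂ t x) x := by
    refine hasDerivAt_space_of_hasDerivAt_time (v := fun s y => (v₁ s y, v₂ s y))
      (β := fun s => (q s x * v₂ s x, -conj (q s x) * v₁ s x - v₂ s x))
      (fun s y => hasDerivAt_laxTimeOp (hq.hasDerivAt s y) (hq.hasDerivAt' s y))
      (continuous_laxTimeOp hc hc') hcoeff
      (hq.hasDerivAt_prodMk h) (fun s => ?_) ((h₁ x).prodMk (h₂ x)) t
    · have hv₁ := h.hasDerivAt_fst s x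
      have hv₂ := h.hasDerivAt_snd s x
      have hzeroCurvature := ((hq.time s x).mul hv₂).prodMk
        (((hasDerivAt_conj (hq.time s x)).neg.mul hv₁).sub hv₂)
      refine hzeroCurvature.congr_deriv ?_
      rw [laxTimeOp, traceFreeOp_apply, traceFreeOp_apply, (hq.hasDerivAt s x).deriv,
        Prod.mk_add_mk]
      simp only [Pi.neg_apply, map_mul, map_add, Complex.conj_I, map_ofNat,
        ← Complex.mul_conj', Complex.conj_conj]
      congr 1 <;> ring
  exact ⟨hpair.fst, hpair.snd⟩

lemma tendsto_of_hasDerivAt_laxTimeOp (hq : RegularSolution q q' q'') {l : Filter ℝ}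
    (hl : l ≤ cocompact ℝ) {w : ℝ → ℝ → ℂ × ℂ} {w₀ : ℝ → ℂ × ℂ}
    (hw : ∀ t x, HasDerivAt (fun s => w s x) (laxTimeOp (q t x) (q' t x) (w t x)) t)
    (hw₀ : ∀ t, HasDerivAt w₀ (laxTimeOp 0 0 (w₀ t)) t) (h0 : Tendsto (w 0) l (𝓝 (w₀ 0)))
    (t : ℝ) : Tendsto (w t) l (𝓝 (w₀ t)) := by
  have hq₀ : TendstoUniformlyOn (fun x s => laxTimeOp (q s x) (q' s x)) (fun _ => laxTimeOp 0 0) l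
      (Set.uIcc 0 t) := by
    have hc0 : Tendsto (fun p : ℝ × ℝ => q p.2 p.1) (cocompact ℝ ×ˢ 𝓟 (Set.uIcc 0 t)) (𝓝 0) :=
      tendsto_prod_principal_iff.2 (hq.c0.tendstoUniformlyOn_cocompact isCompact_uIcc)
    have hc0' : Tendsto (fun p : ℝ × ℝ => q' p.2 p.1) (cocompact ℝ ×ˢ 𝓟 (Set.uIcc 0 t)) (𝓝 0) :=
      tendsto_prod_principal_iff.2 (hq.c0'.tendstoUniformlyOn_cocompact isCompact_uIcc)
    exact tendsto_prod_principal_iff.1 <|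
      (tendsto_laxTimeOp hc0 hc0').mono_left (Filter.prod_mono_left _ hl)
  refine tendsto_of_hasDerivAt_linear (A := fun x s => laxTimeOp (q s x) (q' s x))
    (A₀ := fun _ => laxTimeOp 0 0) (f := fun _ _ => 0) (f₀ := fun _ => 0)
    (u := fun x s => w s x) (a := 0) (fun x s => ?_) (fun s => ?_) continuous_const hq₀
    (fun _ hU => Eventually.of_forall fun _ _ _ => refl_mem_uniformity hU) h0
  · rw [add_zero]
    exact hw s x
  · rw [add_zero]
    exact hw₀ s

/-- The reflection `-q̄(-t, -x)` exchanges the two Jost solutions. -/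
lemma reflect (hq : RegularSolution q q' q'') :
    RegularSolution (fun t x => -conj (q (-t) (-x))) (fun t x => conj (q' (-t) (-x)))
      (fun t x => -conj (q'' (-t) (-x))) := by
  refine ⟨fun t x => ?_, fun t x => ?_, hq.c0.conj_reflect.neg, hq.c0'.conj_reflect,
    hq.c0''.conj_reflect.neg, hq.l2.conj_reflect.neg, hq.l2'.conj_reflect,
    hq.l2''.conj_reflect.neg, fun t x => ?_⟩
  · exact (hasDerivAt_conj ((hq.hasDerivAt (-t) (-x)).scomp x (hasDerivAt_neg x))).neg.congr_deriv
      (by simp)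
  · exact (hasDerivAt_conj ((hq.hasDerivAt' (-t) (-x)).scomp x (hasDerivAt_neg x))).congr_deriv
      (by simp)
  · refine (hasDerivAt_conj ((hq.time (-t) (-x)).scomp t (hasDerivAt_neg t))).neg.congr_deriv ?_
    simp only [neg_smul, one_smul, map_neg, map_mul, map_add, Complex.conj_I, map_ofNat, map_pow,
      Complex.conj_ofReal, norm_neg, RCLike.norm_conj]
    ring

lemma tendsto_of_solvesLaxTime (hq : RegularSolution q q' q'') (h : SolvesLaxTime q v₁ v₂)
    {l : Filter ℝ} (hl : l ≤ cocompact ℝ) {z : ℂ} {r : ℝ → ℂ}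
    (h₁ : Tendsto (fun x => r x * v₁ 0 x) l (𝓝 z)) (h₂ : Tendsto (fun x => r x * v₂ 0 x) l (𝓝 0))
    (t : ℝ) : Tendsto (fun x => r x * v₁ t x) l (𝓝 (Complex.exp (Complex.I * t / 2) * z)) ∧
      Tendsto (fun x => r x * v₂ t x) l (𝓝 0) := by
  have hexp : ∀ t : ℝ, HasDerivAt (fun s : ℝ => (Complex.exp (Complex.I * s / 2) * z, (0 : ℂ)))
      (laxTimeOp 0 0 (Complex.exp (Complex.I * t / 2) * z, 0)) t := fun t => by
    have hphase : HasDerivAt (fun s : ℝ => Complex.I * s / 2) (Complex.I / 2) t := by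
      simpa using (((hasDerivAt_id t).ofReal_comp).const_mul Complex.I).div_const 2
    refine ((hphase.cexp.mul_const z).prodMk (hasDerivAt_const t 0)).congr_deriv ?_
    rw [laxTimeOp, traceFreeOp_apply]
    simp only [map_zero]
    congr 1 <;> ring
  have hpair := hq.tendsto_of_hasDerivAt_laxTimeOp hl (w := fun t x => (r x * v₁ t x, r x * v₂ t x))
    (w₀ := fun s => (Complex.exp (Complex.I * s / 2) * z, 0)) (fun s x => ?_) hexp ?_ t
  · exact Prod.tendsto_iff _ _ |>.1 hpair
  · refine (((h.hasDerivAt_fst s x).const_mul (r x)).prodMk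
      ((h.hasDerivAt_snd s x).const_mul (r x))).congr_deriv ?_
    rw [laxTimeOp, traceFreeOp_apply, (hq.hasDerivAt s x).deriv, Complex.mul_conj']
    congr 1 <;> ring
  · simpa using h₁.prodMk_nhds h₂

variable {φ₁ φ₂ χ₁ χ₂ : ℝ → ℝ → ℂ} {δ : ℝ}

lemma isJostPhi (hq : RegularSolution q q' q'') (hδ : HasL2Bound (q 0) δ) (hδ1 : δ ^ 2 ≤ 1 / 8)
    (h0 : IsJostPhi (q 0) (φ₁ 0) (φ₂ 0)) (h : SolvesLaxTime q φ₁ φ₂) (t : ℝ) :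
    IsJostPhi (q t) (fun x => Complex.exp (-(Complex.I * t / 2)) * φ₁ t x)
      (fun x => Complex.exp (-(Complex.I * t / 2)) * φ₂ t x) := by
  have hspace := hq.hasDerivAt_space_of_solvesLaxTime h h0.hasDerivAt_fst h0.hasDerivAt_snd t
  refine ⟨fun x => ?_, fun x => ?_, ?_, ?_⟩
  · exact ((hspace x).1.const_mul _).congr_deriv (by ring)
  · exact ((hspace x).2.const_mul _).congr_deriv (by ring)
  · have hlim := (hq.tendsto_of_solvesLaxTime h atTop_le_cocompact (r := 1) (z := 1)
      (by simpa using h0.tendsto_fst) (by simpa using h0.tendsto_snd_atTop hδ hδ1) t).1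
    simpa [← Complex.exp_add] using hlim.const_mul (Complex.exp (-(Complex.I * t / 2)))
  · have hfst : Tendsto (fun x : ℝ => (Real.exp x : ℂ) * φ₁ 0 x) atBot (𝓝 0) := by
      have hbound := Real.tendsto_exp_atBot.mul_const 4
      rw [zero_mul] at hbound
      refine squeeze_zero_norm (fun x => ?_) hbound
      rw [norm_mul, Complex.norm_real, Real.norm_eq_abs, Real.abs_exp]
      gcongr
      exact h0.norm_fst_le hδ hδ1 x
    have hlim := (hq.tendsto_of_solvesLaxTime h atBot_le_cocompact hfst h0.tendsto_snd t).2
    simpa [mul_left_comm] using hlim.const_mul (Complex.exp (-(Complex.I * t / 2)))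

lemma isJostChi (hq : RegularSolution q q' q'') (hδ : HasL2Bound (q 0) δ) (hδ1 : δ ^ 2 ≤ 1 / 8)
    (h0 : IsJostChi (q 0) (χ₁ 0) (χ₂ 0)) (h : SolvesLaxTime q χ₁ χ₂) (t : ℝ) :
    IsJostChi (q t) (fun x => Complex.exp (Complex.I * t / 2) * χ₁ t x)
      (fun x => Complex.exp (Complex.I * t / 2) * χ₂ t x) := by
  have hr := hq.reflect
  have hlax : SolvesLaxTime (fun t x => -conj (q (-t) (-x))) (fun t x => -χ₂ (-t) (-x))
      (fun t x => χ₁ (-t) (-x)) := by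
    refine ⟨fun s x => ?_, fun s x => ?_⟩
    · refine (((h.hasDerivAt_snd (-s) (-x)).scomp s (hasDerivAt_neg s)).neg).congr_deriv ?_
      rw [(hr.hasDerivAt s x).deriv, (hq.hasDerivAt (-s) (-x)).deriv, norm_neg, RCLike.norm_conj]
      simp only [neg_smul, one_smul]
      ring
    · refine ((h.hasDerivAt_fst (-s) (-x)).scomp s (hasDerivAt_neg s)).congr_deriv ?_
      rw [(hr.hasDerivAt s x).deriv, (hq.hasDerivAt (-s) (-x)).deriv, norm_neg, RCLike.norm_conj]
      simp only [neg_smul, one_smul, map_neg, Complex.conj_conj]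
      ring
  have hreflect := hr.isJostPhi (φ₁ := fun t x => -χ₂ (-t) (-x)) (φ₂ := fun t x => χ₁ (-t) (-x))
    (by simpa using hδ.neg_conj_comp_neg) hδ1 (by simpa using h0.isJostPhi_reflect) hlax (-t)
  simpa [neg_div] using hreflect.isJostChi_reflect

end RegularSolution

/-! ### The Darboux pair of a solution of the Lax pair -/

/-- The off-diagonal entry `u v̄ / (|u|² + |v|²)` of the orthogonal projection onto the line spanned
by `(u, v)`. -/
def projOffDiag (u v : ℂ) : ℂ := u * conj v / (u * conj u + v * conj v)

/-- The difference `(|u|² - |v|²) / (|u|² + |v|²)` of the diagonal entries of the orthogonal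
projection onto the line spanned by `(u, v)`. -/
def projDiag (u v : ℂ) : ℂ := (u * conj u - v * conj v) / (u * conj u + v * conj v)

lemma mul_conj_add_mul_conj_ne_zero {u v : ℂ} (h : u ≠ 0 ∨ v ≠ 0) :
    u * conj u + v * conj v ≠ 0 := by
  rw [Complex.mul_conj, Complex.mul_conj, ← Complex.ofReal_add, Complex.ofReal_ne_zero]
  rcases h with h | h
  · linarith [Complex.normSq_pos.2 h, Complex.normSq_nonneg v]
  · linarith [Complex.normSq_pos.2 h, Complex.normSq_nonneg u]

lemma conj_projDiag (u v : ℂ) : conj (projDiag u v) = projDiag u v := by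
  simp only [projDiag, map_div₀, map_mul, map_add, map_sub, Complex.conj_conj, mul_comm]

lemma conj_projOffDiag (u v : ℂ) :
    conj (projOffDiag u v) = conj u * v / (u * conj u + v * conj v) := by
  simp only [projOffDiag, map_div₀, map_mul, map_add, Complex.conj_conj, mul_comm]

lemma projDiag_sq {u v : ℂ} (h : u ≠ 0 ∨ v ≠ 0) :
    projDiag u v ^ 2 = 1 - 4 * (projOffDiag u v * conj (projOffDiag u v)) := by
  have hN := mul_conj_add_mul_conj_ne_zero h
  rw [conj_projOffDiag, projDiag, projOffDiag]
  field_simp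
  ring

section LinearFlow

variable {u v : ℝ → ℂ} {a b c : ℂ} {s : ℝ}

lemma hasDerivAt_projOffDiag (hu : HasDerivAt u (a * u s + b * v s) s)
    (hv : HasDerivAt v (c * u s - a * v s) s) (h : u s ≠ 0 ∨ v s ≠ 0) :
    HasDerivAt (fun s => projOffDiag (u s) (v s))
      ((a - conj a) * projOffDiag (u s) (v s) + b * (1 - projDiag (u s) (v s)) / 2
        + conj c * (1 + projDiag (u s) (v s)) / 2 - projOffDiag (u s) (v s)
          * ((a + conj a) * projDiag (u s) (v s) + (b + conj c) * conj (projOffDiag (u s) (v s))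
            + (conj b + c) * projOffDiag (u s) (v s))) s := by
  have hN := mul_conj_add_mul_conj_ne_zero h
  have hu' := hasDerivAt_conj hu
  have hv' := hasDerivAt_conj hv
  refine ((hu.mul hv').div ((hu.mul hu').add (hv.mul hv')) hN).congr_deriv ?_
  rw [conj_projOffDiag]
  simp only [projOffDiag, projDiag, Pi.mul_apply, Pi.add_apply, map_mul, map_add,
    map_sub]
  field_simp
  ring

lemma hasDerivAt_projDiag (hu : HasDerivAt u (a * u s + b * v s) s)
    (hv : HasDerivAt v (c * u s - a * v s) s) (h : u s ≠ 0 ∨ v s ≠ 0) :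
    HasDerivAt (fun s => projDiag (u s) (v s))
      (a + conj a + (b - conj c) * conj (projOffDiag (u s) (v s))
        + (conj b - c) * projOffDiag (u s) (v s) - projDiag (u s) (v s)
          * ((a + conj a) * projDiag (u s) (v s) + (b + conj c) * conj (projOffDiag (u s) (v s))
            + (conj b + c) * projOffDiag (u s) (v s))) s := by
  have hN := mul_conj_add_mul_conj_ne_zero h
  have hu' := hasDerivAt_conj hu
  have hv' := hasDerivAt_conj hv
  refine (((hu.mul hu').sub (hv.mul hv')).div ((hu.mul hu').add (hv.mul hv')) hN).congr_deriv ?_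
  rw [conj_projOffDiag]
  simp only [projOffDiag, projDiag, Pi.mul_apply, Pi.add_apply, Pi.sub_apply,
    map_mul, map_add, map_sub]
  field_simp
  ring

end LinearFlow

/-- The differential equations satisfied by `p = projOffDiag ψ₁ ψ₂` and `k = projDiag ψ₁ ψ₂` when
`(ψ₁, ψ₂)` solves both equations of the Lax pair of `q`; `q'` stands for `∂ₓ q`. -/
structure IsDarbouxPair (q q' p k : ℝ → ℝ → ℂ) : Prop where
  space_p : ∀ t x, HasDerivAt (p t) (-(k t x * (q t x + p t x))) x
  space_k : ∀ t x, HasDerivAt (k t) (4 * (p t x * conj (p t x))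
    + 2 * (conj (q t x) * p t x + q t x * conj (p t x))) x
  time_p : ∀ t x, HasDerivAt (fun s => p s x)
    (Complex.I * (((1 + 2 * (q t x * conj (q t x)))
      + 2 * (conj (q t x) * p t x - q t x * conj (p t x))) * p t x + q t x - k t x * q' t x)) t
  continuous_time_k : ∀ x, Continuous fun t => k t x
  conj_k : ∀ t x, conj (k t x) = k t x
  sq_k : ∀ t x, k t x ^ 2 = 1 - 4 * (p t x * conj (p t x))

lemma RegularSolution.isDarbouxPair {q q' q'' ψ₁ ψ₂ : ℝ → ℝ → ℂ} (hq : RegularSolution q q' q'')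
    (hψ₁ : ∀ t x, HasDerivAt (ψ₁ t) (1 / 2 * ψ₁ t x + q t x * ψ₂ t x) x)
    (hψ₂ : ∀ t x, HasDerivAt (ψ₂ t) (-conj (q t x) * ψ₁ t x - 1 / 2 * ψ₂ t x) x)
    (hψ : SolvesLaxTime q ψ₁ ψ₂) (hne : ∀ t x, ψ₁ t x ≠ 0 ∨ ψ₂ t x ≠ 0) :
    IsDarbouxPair q q' (fun t x => projOffDiag (ψ₁ t x) (ψ₂ t x))
      (fun t x => projDiag (ψ₁ t x) (ψ₂ t x)) := by
  have ht₁ : ∀ t x, HasDerivAt (fun s => ψ₁ s x) (Complex.I * (1 / 2 + q t x * conj (q t x))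
      * ψ₁ t x + Complex.I * (q' t x + q t x) * ψ₂ t x) t := fun t x => by
    refine (hψ.hasDerivAt_fst t x).congr_deriv ?_
    rw [(hq.hasDerivAt t x).deriv, Complex.mul_conj']
    ring
  have ht₂ : ∀ t x, HasDerivAt (fun s => ψ₂ s x) (Complex.I * (conj (q' t x) - conj (q t x))
      * ψ₁ t x - Complex.I * (1 / 2 + q t x * conj (q t x)) * ψ₂ t x) t := fun t x => by
    refine (hψ.hasDerivAt_snd t x).congr_deriv ?_
    rw [(hq.hasDerivAt t x).deriv, Complex.mul_conj']
    ring
  have hsq := fun t x => projDiag_sq (hne t x)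
  refine ⟨fun t x => ?_, fun t x => ?_, fun t x => ?_, fun x => ?_, fun t x => conj_projDiag _ _,
    hsq⟩
  · refine (hasDerivAt_projOffDiag (hψ₁ t x) (hψ₂ t x) (hne t x)).congr_deriv ?_
    simp only [map_div₀, map_one, map_ofNat, map_neg, Complex.conj_conj]
    ring
  · refine (hasDerivAt_projDiag (hψ₁ t x) (hψ₂ t x) (hne t x)).congr_deriv ?_
    simp only [map_div₀, map_one, map_ofNat, map_neg, Complex.conj_conj]
    linear_combination -hsq t x
  · refine (hasDerivAt_projOffDiag (u := fun s => ψ₁ s x) (v := fun s => ψ₂ s x) (ht₁ t x) (ht₂ t x)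
      (hne t x)).congr_deriv ?_
    simp only [map_mul, map_add, map_sub, map_div₀, map_one, map_ofNat, Complex.conj_I,
      Complex.conj_conj]
    ring
  · exact continuous_iff_continuousAt.2 fun t =>
      (hasDerivAt_projDiag (u := fun s => ψ₁ s x) (v := fun s => ψ₂ s x) (ht₁ t x) (ht₂ t x)
        (hne t x)).continuousAt

/-- The derivative of `p` in `x`, for a Darboux pair `p`, `k`. -/
def offDiagDeriv₁ (q p k : ℝ → ℝ → ℂ) (t x : ℝ) : ℂ := -(k t x * (q t x + p t x))

/-- The derivative of `k` in `x`, for a Darboux pair `p`, `k`. -/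
def diagDeriv₁ (q p : ℝ → ℝ → ℂ) (t x : ℝ) : ℂ :=
  4 * (p t x * conj (p t x)) + 2 * (conj (q t x) * p t x + q t x * conj (p t x))

/-- The second derivative of `p` in `x`, for a Darboux pair `p`, `k`. -/
def offDiagDeriv₂ (q q' p k : ℝ → ℝ → ℂ) (t x : ℝ) : ℂ :=
  -(diagDeriv₁ q p t x * (q t x + p t x) + k t x * (q' t x + offDiagDeriv₁ q p k t x))

/-- The second derivative of `k` in `x`, for a Darboux pair `p`, `k`. -/
def diagDeriv₂ (q q' p k : ℝ → ℝ → ℂ) (t x : ℝ) : ℂ :=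
  4 * (offDiagDeriv₁ q p k t x * conj (p t x) + p t x * conj (offDiagDeriv₁ q p k t x))
    + 2 * ((conj (q' t x) * p t x + conj (q t x) * offDiagDeriv₁ q p k t x)
      + (q' t x * conj (p t x) + q t x * conj (offDiagDeriv₁ q p k t x)))

/-- The third derivative of `p` in `x`, for a Darboux pair `p`, `k`. -/
def offDiagDeriv₃ (q q' q'' p k : ℝ → ℝ → ℂ) (t x : ℝ) : ℂ :=
  -(diagDeriv₂ q q' p k t x * (q t x + p t x)
      + diagDeriv₁ q p t x * (q' t x + offDiagDeriv₁ q p k t x)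
    + (diagDeriv₁ q p t x * (q' t x + offDiagDeriv₁ q p k t x)
      + k t x * (q'' t x + offDiagDeriv₂ q q' p k t x)))

namespace IsDarbouxPair

variable {q q' q'' p k : ℝ → ℝ → ℂ}

lemma norm_sq_add (h : IsDarbouxPair q q' p k) (t x : ℝ) :
    ‖k t x‖ ^ 2 + 4 * ‖p t x‖ ^ 2 = 1 := by
  have hsq := h.sq_k t x
  nth_rewrite 1 [sq, ← h.conj_k, mul_comm] at hsq
  rw [Complex.mul_conj', Complex.mul_conj'] at hsq
  have hreal : ‖k t x‖ ^ 2 = 1 - 4 * ‖p t x‖ ^ 2 := by exact_mod_cast hsq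
  linarith

lemma norm_k_le (h : IsDarbouxPair q q' p k) (t x : ℝ) : ‖k t x‖ ≤ 1 := by
  nlinarith [h.norm_sq_add t x, norm_nonneg (k t x), norm_nonneg (p t x)]

lemma norm_p_le (h : IsDarbouxPair q q' p k) (t x : ℝ) : ‖p t x‖ ≤ 1 := by
  nlinarith [h.norm_sq_add t x, norm_nonneg (k t x), norm_nonneg (p t x)]

lemma hasDerivAt_offDiagDeriv₁ (h : IsDarbouxPair q q' p k) (hq : RegularSolution q q' q'')
    (t x : ℝ) : HasDerivAt (offDiagDeriv₁ q p k t) (offDiagDeriv₂ q q' p k t x) x :=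
  ((h.space_k t x).mul ((hq.hasDerivAt t x).add (h.space_p t x))).neg

lemma hasDerivAt_diagDeriv₁ (h : IsDarbouxPair q q' p k) (hq : RegularSolution q q' q'')
    (t x : ℝ) : HasDerivAt (diagDeriv₁ q p t) (diagDeriv₂ q q' p k t x) x := by
  have hp := h.space_p t x
  have hq := hq.hasDerivAt t x
  exact ((hp.mul (hasDerivAt_conj hp)).const_mul 4).add
    ((((hasDerivAt_conj hq).mul hp).add (hq.mul (hasDerivAt_conj hp))).const_mul 2)

lemma hasDerivAt_offDiagDeriv₂ (h : IsDarbouxPair q q' p k) (hq : RegularSolution q q' q'')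
    (t x : ℝ) : HasDerivAt (offDiagDeriv₂ q q' p k t) (offDiagDeriv₃ q q' q'' p k t x) x :=
  (((h.hasDerivAt_diagDeriv₁ hq t x).mul ((hq.hasDerivAt t x).add (h.space_p t x))).add
    ((h.space_k t x).mul ((hq.hasDerivAt' t x).add (h.hasDerivAt_offDiagDeriv₁ hq t x)))).neg

lemma hasDerivAt_time (h : IsDarbouxPair q q' p k) (hq : RegularSolution q q' q'') (t x : ℝ) :
    HasDerivAt (fun s => -q s x - 2 * p s x)
      (Complex.I * (-q'' t x - 2 * offDiagDeriv₂ q q' p k t x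
        + 2 * (‖-q t x - 2 * p t x‖ : ℂ) ^ 2 * (-q t x - 2 * p t x))) t := by
  refine ((hq.time t x).neg.sub ((h.time_p t x).const_mul 2)).congr_deriv ?_
  rw [← Complex.mul_conj', ← Complex.mul_conj']
  simp only [offDiagDeriv₂, offDiagDeriv₁, diagDeriv₁, map_sub, map_neg, map_mul, map_ofNat]
  linear_combination 2 * Complex.I * (q t x + p t x) * h.sq_k t x

lemma deriv_deriv (h : IsDarbouxPair q q' p k) (hq : RegularSolution q q' q'') (t x : ℝ) :
    deriv (deriv fun y => -q t y - 2 * p t y) x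
      = -q'' t x - 2 * offDiagDeriv₂ q q' p k t x := by
  have hfirst : (deriv fun y => -q t y - 2 * p t y)
      = fun y => -q' t y - 2 * offDiagDeriv₁ q p k t y :=
    funext fun y => ((hq.hasDerivAt t y).neg.sub ((h.space_p t y).const_mul 2)).deriv
  rw [hfirst]
  exact ((hq.hasDerivAt' t x).neg.sub ((h.hasDerivAt_offDiagDeriv₁ hq t x).const_mul 2)).deriv

lemma equation (h : IsDarbouxPair q q' p k) (hq : RegularSolution q q' q'') (t x : ℝ) :
    Complex.I * deriv (fun s => -q s x - 2 * p s x) t + deriv (deriv fun y => -q t y - 2 * p t y) x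
      + 2 * (‖-q t x - 2 * p t x‖ : ℂ) ^ 2 * (-q t x - 2 * p t x) = 0 := by
  rw [(h.hasDerivAt_time hq t x).deriv, h.deriv_deriv hq, ← mul_assoc, Complex.I_mul_I]
  ring

end IsDarbouxPair

/-! ### Bounded coefficients acting on curves in `L²(ℝ)` -/

lemma tendsto_eLpNorm_zero_of_dominated {α ι E : Type*} [MeasurableSpace α] {μ : Measure α}
    [NormedAddCommGroup E] {l : Filter ι} [l.IsCountablyGenerated] {p : ENNReal} (hp₀ : p ≠ 0)
    (hp : p ≠ ⊤) {F : ι → α → E} {g : α → ℝ} (hg : MemLp g p μ)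
    (hF : ∀ i, AEStronglyMeasurable (F i) μ) (hFg : ∀ᶠ i in l, ∀ᵐ x ∂μ, ‖F i x‖ ≤ g x)
    (hlim : ∀ᵐ x ∂μ, Tendsto (fun i => F i x) l (𝓝 0)) :
    Tendsto (fun i => eLpNorm (F i) p μ) l (𝓝 0) := by
  have hp' := ENNReal.toReal_pos hp₀ hp
  have hpow : Tendsto (fun i => ∫⁻ x, ‖F i x‖ₑ ^ p.toReal ∂μ) l (𝓝 (∫⁻ _, 0 ∂μ)) := by
    refine tendsto_lintegral_filter_of_dominated_convergence' (fun x => ‖g x‖ₑ ^ p.toReal)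
      (Eventually.of_forall fun i => (hF i).enorm.pow_const _) ?_
      (lintegral_rpow_enorm_lt_top_of_eLpNorm_lt_top hp₀ hp hg.2).ne ?_
    · filter_upwards [hFg] with i hi
      filter_upwards [hi] with x hx
      gcongr
      exact enorm_le_iff_norm_le.2 (hx.trans (le_abs_self _))
    · filter_upwards [hlim] with x hx
      have henorm := ((ENNReal.continuous_rpow_const (y := p.toReal)).tendsto _).comp hx.enorm
      simpa [Function.comp_def, ENNReal.zero_rpow_of_pos hp'] using henorm
  simp_rw [eLpNorm_eq_lintegral_rpow_enorm_toReal hp₀ hp]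
  have hroot := (ENNReal.continuous_rpow_const (y := 1 / p.toReal)).tendsto (∫⁻ _, 0 ∂μ)
  rw [lintegral_zero, ENNReal.zero_rpow_of_pos (by positivity)] at hroot
  exact hroot.comp (by simpa using hpow)

lemma eLpNorm_two_sq {α E : Type*} [MeasurableSpace α] [NormedAddCommGroup E] (f : α → E)
    (μ : Measure α) : eLpNorm f 2 μ ^ 2 = ∫⁻ x, ‖f x‖ₑ ^ 2 ∂μ := by
  simpa using eLpNorm_nnreal_pow_eq_lintegral (f := f) (μ := μ) two_ne_zero

/-- `k` is continuous in each variable and bounded, locally uniformly in time; multiplication by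
such a `k` preserves continuous curves in `L²(ℝ)`. -/
structure IsBoundedCoeff (k : ℝ → ℝ → ℂ) : Prop where
  continuous_space : ∀ t, Continuous (k t)
  continuous_time : ∀ x, Continuous fun t => k t x
  bound : ∀ t₀, ∃ K, ∀ᶠ t in 𝓝 t₀, ∀ x, ‖k t x‖ ≤ K

namespace IsBoundedCoeff

variable {f g : ℝ → ℝ → ℂ}

lemma const (c : ℂ) : IsBoundedCoeff fun _ _ => c :=
  ⟨fun _ => continuous_const, fun _ => continuous_const, fun _ => ⟨‖c‖, by simp⟩⟩

lemma add (hf : IsBoundedCoeff f) (hg : IsBoundedCoeff g) :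
    IsBoundedCoeff fun t x => f t x + g t x := by
  refine ⟨fun t => (hf.continuous_space t).add (hg.continuous_space t),
    fun x => (hf.continuous_time x).add (hg.continuous_time x), fun t₀ => ?_⟩
  obtain ⟨K, hK⟩ := hf.bound t₀
  obtain ⟨L, hL⟩ := hg.bound t₀
  refine ⟨K + L, ?_⟩
  filter_upwards [hK, hL] with t hft hgt x using norm_add_le_of_le (hft x) (hgt x)

lemma mul (hf : IsBoundedCoeff f) (hg : IsBoundedCoeff g) :
    IsBoundedCoeff fun t x => f t x * g t x := by
  refine ⟨fun t => (hf.continuous_space t).mul (hg.continuous_space t),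
    fun x => (hf.continuous_time x).mul (hg.continuous_time x), fun t₀ => ?_⟩
  obtain ⟨K, hK⟩ := hf.bound t₀
  obtain ⟨L, hL⟩ := hg.bound t₀
  refine ⟨K * L, ?_⟩
  filter_upwards [hK, hL] with t hft hgt x using norm_mul_le_of_le (hft x) (hgt x)

lemma neg (hf : IsBoundedCoeff f) : IsBoundedCoeff fun t x => -f t x := by
  simpa using (const (-1)).mul hf

lemma sub (hf : IsBoundedCoeff f) (hg : IsBoundedCoeff g) :
    IsBoundedCoeff fun t x => f t x - g t x := by
  simpa only [sub_eq_add_neg] using hf.add hg.neg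

lemma star (hf : IsBoundedCoeff f) : IsBoundedCoeff fun t x => conj (f t x) := by
  refine ⟨fun t => Complex.continuous_conj.comp (hf.continuous_space t),
    fun x => Complex.continuous_conj.comp (hf.continuous_time x), fun t₀ => ?_⟩
  simpa only [RCLike.norm_conj] using hf.bound t₀

lemma tendsto_eLpNorm_sub_mul (hf : IsBoundedCoeff f) {u : ℝ → ℂ} (hu : MemLp u 2) (t₀ : ℝ) :
    Tendsto (fun t => eLpNorm (fun x => (f t x - f t₀ x) * u x) 2) (𝓝 t₀) (𝓝 0) := by
  obtain ⟨K, hK⟩ := hf.bound t₀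
  refine tendsto_eLpNorm_zero_of_dominated two_ne_zero ENNReal.ofNat_ne_top
    (hu.norm.const_mul (K + K)) (fun t => ?_) ?_ (ae_of_all _ fun x => ?_)
  · exact ((hf.continuous_space t).sub (hf.continuous_space t₀)).aestronglyMeasurable.mul hu.1
  · filter_upwards [hK] with t ht
    exact ae_of_all _ fun x =>
      norm_mul_le_of_le (norm_sub_le_of_le (ht x) (hK.self_of_nhds x)) le_rfl
  · simpa using (((hf.continuous_time x).tendsto t₀).sub_const (f t₀ x)).mul_const (u x)

end IsBoundedCoeff

lemma ContinuousInC0.isBoundedCoeff {f : ℝ → ℝ → ℂ} (hf : ContinuousInC0 f) :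
    IsBoundedCoeff f := by
  refine ⟨hf.continuous, fun x => hf.continuous_uncurry.comp (.prodMk_left x), fun t₀ => ?_⟩
  obtain ⟨K, -, hK⟩ := hf.exists_norm_le (isCompact_closedBall t₀ 1)
  exact ⟨K, eventually_of_mem (Metric.closedBall_mem_nhds t₀ one_pos) hK⟩

/-- `t ↦ f t` is a locally bounded family in `L²(ℝ)`. -/
structure LocallyBoundedInL2 (f : ℝ → ℝ → ℂ) : Prop where
  aestronglyMeasurable : ∀ t, AEStronglyMeasurable (f t) volume
  bound : ∀ t₀, ∃ C : ENNReal, C ≠ ⊤ ∧ ∀ᶠ t in 𝓝 t₀, eLpNorm (f t) 2 ≤ C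

namespace LocallyBoundedInL2

variable {f g k : ℝ → ℝ → ℂ}

lemma memLp (hf : LocallyBoundedInL2 f) (t : ℝ) : MemLp (f t) 2 := by
  obtain ⟨C, hC, hbound⟩ := hf.bound t
  exact ⟨hf.aestronglyMeasurable t, hbound.self_of_nhds.trans_lt hC.lt_top⟩

lemma add (hf : LocallyBoundedInL2 f) (hg : LocallyBoundedInL2 g) :
    LocallyBoundedInL2 fun t x => f t x + g t x := by
  refine ⟨fun t => (hf.aestronglyMeasurable t).add (hg.aestronglyMeasurable t), fun t₀ => ?_⟩
  obtain ⟨C, hC, hfC⟩ := hf.bound t₀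
  obtain ⟨D, hD, hgD⟩ := hg.bound t₀
  refine ⟨C + D, ENNReal.add_ne_top.2 ⟨hC, hD⟩, ?_⟩
  filter_upwards [hfC, hgD] with t hft hgt
  exact (eLpNorm_add_le (hf.aestronglyMeasurable t) (hg.aestronglyMeasurable t)
    one_le_two).trans (add_le_add hft hgt)

lemma mul_left (hk : IsBoundedCoeff k) (hf : LocallyBoundedInL2 f) :
    LocallyBoundedInL2 fun t x => k t x * f t x := by
  refine ⟨fun t => (hk.continuous_space t).aestronglyMeasurable.mul (hf.aestronglyMeasurable t),
    fun t₀ => ?_⟩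
  obtain ⟨K, hK⟩ := hk.bound t₀
  obtain ⟨C, hC, hfC⟩ := hf.bound t₀
  refine ⟨ENNReal.ofReal K * C, ENNReal.mul_ne_top ENNReal.ofReal_ne_top hC, ?_⟩
  filter_upwards [hK, hfC] with t hkt hft
  refine (eLpNorm_le_mul_eLpNorm_of_ae_le_mul (ae_of_all _ fun x => ?_) 2).trans (by gcongr)
  exact norm_mul_le_of_le (hkt x) le_rfl

lemma sub (hf : LocallyBoundedInL2 f) (hg : LocallyBoundedInL2 g) :
    LocallyBoundedInL2 fun t x => f t x - g t x := by
  simpa [sub_eq_add_neg] using hf.add (mul_left (.const (-1)) hg)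

end LocallyBoundedInL2

section TimeDerivative

variable {f f' : ℝ → ℝ → ℂ}

lemma enorm_sub_sq_le_of_hasDerivAt {E : Type*} [NormedAddCommGroup E] [NormedSpace ℝ E]
    [CompleteSpace E] {u u' : ℝ → E} (hu : ∀ s, HasDerivAt u (u' s) s) (hu' : Continuous u')
    (a b : ℝ) : ‖u b - u a‖ₑ ^ 2 ≤ ENNReal.ofReal |b - a| * ∫⁻ s in Set.uIoc a b, ‖u' s‖ₑ ^ 2 := by
  set μ := volume.restrict (Set.uIoc a b) with hμ
  have hmass : μ Set.univ = ENNReal.ofReal |b - a| := by simp [hμ]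
  have hL1 : ‖u b - u a‖ₑ ≤ eLpNorm u' 1 μ := by
    rw [← intervalIntegral.integral_eq_sub_of_hasDerivAt (fun s _ => hu s)
        (hu'.intervalIntegrable _ _), eLpNorm_one_eq_lintegral_enorm, ← enorm_norm,
      intervalIntegral.norm_intervalIntegral_eq, enorm_norm]
    exact enorm_integral_le_lintegral_enorm _
  have hL2 : eLpNorm u' 1 μ ≤ eLpNorm u' 2 μ * ENNReal.ofReal |b - a| ^ (1 / 2 : ℝ) := by
    convert eLpNorm_le_eLpNorm_mul_rpow_measure_univ (μ := μ) one_le_two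
      hu'.aestronglyMeasurable using 2
    rw [hmass]
    norm_num
  calc ‖u b - u a‖ₑ ^ 2 ≤ (eLpNorm u' 2 μ * ENNReal.ofReal |b - a| ^ (1 / 2 : ℝ)) ^ 2 :=
        pow_le_pow_left₀ zero_le (hL1.trans hL2) 2
    _ = ENNReal.ofReal |b - a| * ∫⁻ s, ‖u' s‖ₑ ^ 2 ∂μ := by
        rw [mul_pow, eLpNorm_two_sq, ← ENNReal.rpow_natCast (_ ^ _), ← ENNReal.rpow_mul, mul_comm]
        norm_num

lemma eLpNorm_sub_sq_le_of_hasDerivAt (hf : ∀ t x, HasDerivAt (fun s => f s x) (f' t x) t)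
    (ht : ∀ x, Continuous fun t => f' t x) (hx : ∀ t, Continuous (f' t)) {a b : ℝ} {C : ENNReal}
    (hC : ∀ s ∈ Set.uIoc a b, eLpNorm (f' s) 2 ≤ C) :
    eLpNorm (f b - f a) 2 ^ 2 ≤ (ENNReal.ofReal |b - a| * C) ^ 2 := by
  have hmeas : Measurable fun z : ℝ × ℝ => f' z.2 z.1 :=
    (measurable_uncurry_of_continuous_of_measurable (u := fun x t => f' t x) hx
      fun x => (ht x).measurable)
  calc eLpNorm (f b - f a) 2 volume ^ 2 = ∫⁻ x, ‖f b x - f a x‖ₑ ^ 2 :=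
        eLpNorm_two_sq (f b - f a) volume
    _ ≤ ∫⁻ x, ENNReal.ofReal |b - a| * ∫⁻ s in Set.uIoc a b, ‖f' s x‖ₑ ^ 2 :=
        lintegral_mono fun x => enorm_sub_sq_le_of_hasDerivAt (fun s => hf s x) (ht x) a b
    _ = ENNReal.ofReal |b - a| * ∫⁻ s in Set.uIoc a b, ∫⁻ x, ‖f' s x‖ₑ ^ 2 := by
        rw [lintegral_const_mul' _ _ ENNReal.ofReal_ne_top, lintegral_lintegral_swap]
        exact (hmeas.enorm.pow_const 2).aemeasurable
    _ ≤ ENNReal.ofReal |b - a| * ∫⁻ _ in Set.uIoc a b, C ^ 2 := by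
        gcongr ENNReal.ofReal |b - a| * ?_
        refine setLIntegral_mono measurable_const fun s hs => ?_
        rw [← eLpNorm_two_sq]
        gcongr
        exact hC s hs
    _ = (ENNReal.ofReal |b - a| * C) ^ 2 := by
        rw [setLIntegral_const, Real.volume_uIoc]
        ring

end TimeDerivative

namespace ContinuousInL2

variable {f g k : ℝ → ℝ → ℂ}

lemma add (hf : ContinuousInL2 f) (hg : ContinuousInL2 g) :
    ContinuousInL2 fun t x => f t x + g t x := by
  refine ⟨fun t => (hf.memLp t).add (hg.memLp t), fun t₀ => ?_⟩
  have hsum := (hf.tendsto t₀).add (hg.tendsto t₀)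
  rw [add_zero] at hsum
  refine tendsto_of_tendsto_of_tendsto_of_le_of_le tendsto_const_nhds hsum (fun _ => zero_le)
    fun t => ?_
  have hsub : (fun x => f t x + g t x) - (fun x => f t₀ x + g t₀ x)
      = (f t - f t₀) + (g t - g t₀) := add_sub_add_comm (f t) (g t) (f t₀) (g t₀)
  rw [hsub]
  exact eLpNorm_add_le ((hf.memLp t).sub (hf.memLp t₀)).1 ((hg.memLp t).sub (hg.memLp t₀)).1
    one_le_two

lemma mul_left (hk : IsBoundedCoeff k) (hf : ContinuousInL2 f) :
    ContinuousInL2 fun t x => k t x * f t x := by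
  have hmem : ∀ t {u : ℝ → ℂ}, MemLp u 2 → MemLp (fun x => k t x * u x) 2 := fun t u hu => by
    obtain ⟨K, hK⟩ := hk.bound t
    exact hu.of_le_mul ((hk.continuous_space t).aestronglyMeasurable.mul hu.1)
      (ae_of_all _ fun x => norm_mul_le_of_le (hK.self_of_nhds x) le_rfl)
  refine ⟨fun t => hmem t (hf.memLp t), fun t₀ => ?_⟩
  obtain ⟨K, hK⟩ := hk.bound t₀
  have hsum := (ENNReal.Tendsto.const_mul (a := ENNReal.ofReal K) (hf.tendsto t₀)
    (Or.inr ENNReal.ofReal_ne_top)).add (hk.tendsto_eLpNorm_sub_mul (hf.memLp t₀) t₀)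
  rw [mul_zero, add_zero] at hsum
  refine tendsto_of_tendsto_of_tendsto_of_le_of_le' tendsto_const_nhds hsum
    (Eventually.of_forall fun _ => zero_le) ?_
  filter_upwards [hK] with t ht
  have hsplit : ((fun x => k t x * f t x) - fun x => k t₀ x * f t₀ x)
      = (fun x => k t x * (f t - f t₀) x) + fun x => (k t x - k t₀ x) * f t₀ x := by
    ext x
    simp only [Pi.sub_apply, Pi.add_apply]
    ring
  rw [hsplit]
  refine (eLpNorm_add_le (hmem t ((hf.memLp t).sub (hf.memLp t₀))).1
    (((hk.continuous_space t).sub (hk.continuous_space t₀)).aestronglyMeasurable.mul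
      (hf.memLp t₀).1) one_le_two).trans (add_le_add_left ?_ _)
  exact eLpNorm_le_mul_eLpNorm_of_ae_le_mul
    (ae_of_all _ fun x => norm_mul_le_of_le (ht x) le_rfl) 2

lemma sub (hf : ContinuousInL2 f) (hg : ContinuousInL2 g) :
    ContinuousInL2 fun t x => f t x - g t x := by
  simpa only [sub_eq_add_neg] using hf.add hg.neg

lemma locallyBoundedInL2 (hf : ContinuousInL2 f) : LocallyBoundedInL2 f := by
  refine ⟨fun t => (hf.memLp t).1, fun t₀ => ⟨1 + eLpNorm (f t₀) 2 volume,
    ENNReal.add_ne_top.2 ⟨ENNReal.one_ne_top, (hf.memLp t₀).2.ne⟩, ?_⟩⟩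
  filter_upwards [(hf.tendsto t₀).eventually_lt_const one_pos] with t ht
  calc eLpNorm (f t) 2 volume = eLpNorm (f t - f t₀ + f t₀) 2 volume := by rw [sub_add_cancel (f t)]
    _ ≤ eLpNorm (f t - f t₀) 2 volume + eLpNorm (f t₀) 2 volume :=
        eLpNorm_add_le ((hf.memLp t).sub (hf.memLp t₀)).1 (hf.memLp t₀).1 one_le_two
    _ ≤ 1 + eLpNorm (f t₀) 2 volume := by gcongr

lemma of_hasDerivAt_time {f' : ℝ → ℝ → ℂ} (hf : ∀ t, MemLp (f t) 2)
    (h : ∀ t x, HasDerivAt (fun s => f s x) (f' t x) t) (ht : ∀ x, Continuous fun t => f' t x)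
    (hx : ∀ t, Continuous (f' t)) (hb : LocallyBoundedInL2 f') : ContinuousInL2 f := by
  refine ⟨hf, fun t₀ => ?_⟩
  obtain ⟨C, hC, hfC⟩ := hb.bound t₀
  obtain ⟨r, hr, hball⟩ := Metric.eventually_nhds_iff_ball.1 hfC
  have hdist : Tendsto (fun t => ENNReal.ofReal |t - t₀| * C) (𝓝 t₀) (𝓝 0) := by
    have habs : Continuous fun t => ENNReal.ofReal |t - t₀| :=
      ENNReal.continuous_ofReal.comp (by fun_prop)
    simpa using ENNReal.Tendsto.mul_const (habs.tendsto t₀) (Or.inr hC)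
  refine tendsto_of_tendsto_of_tendsto_of_le_of_le' tendsto_const_nhds hdist
    (Eventually.of_forall fun _ => zero_le) ?_
  filter_upwards [Metric.ball_mem_nhds t₀ hr] with t htr
  refine (ENNReal.pow_le_pow_left_iff two_ne_zero).1
    (eLpNorm_sub_sq_le_of_hasDerivAt h ht hx fun s hs => ?_)
  exact hball s (((convex_ball t₀ r).ordConnected.uIcc_subset (Metric.mem_ball_self hr) htr)
    (Set.uIoc_subset_uIcc hs))

end ContinuousInL2

/-! ### The Darboux transform preserves `C(ℝ; H³(ℝ))` -/

lemma continuousInSobolev_three {u u' u'' u₃ : ℝ → ℝ → ℂ} (hcont : ∀ t, Continuous (u t))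
    (hu : ContinuousInL2 u) (hu' : ContinuousInL2 u') (hu'' : ContinuousInL2 u'')
    (hu₃ : ContinuousInL2 u₃) (hd : ∀ t, IsWeakDeriv (u t) (u' t))
    (hd' : ∀ t, IsWeakDeriv (u' t) (u'' t)) (hd'' : ∀ t, IsWeakDeriv (u'' t) (u₃ t)) :
    ContinuousInSobolev 3 u := by
  let D : ℕ → ℝ → ℝ → ℂ := fun j => match j with
    | 0 => u
    | 1 => u'
    | 2 => u''
    | _ => u₃
  have hD : ∀ j ≤ 3, ContinuousInL2 (D j) := by
    intro j hj
    interval_cases j <;> assumption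
  refine ⟨hcont, D, rfl, fun j hj t => ?_, fun j hj => (hD j hj).memLp,
    fun j hj => (hD j hj).tendsto⟩
  interval_cases j
  exacts [hd t, hd' t, hd'' t]

namespace IsDarbouxPair

variable {q q' q'' p k : ℝ → ℝ → ℂ}

lemma isBoundedCoeff_p (h : IsDarbouxPair q q' p k) : IsBoundedCoeff p :=
  ⟨fun t => continuous_iff_continuousAt.2 fun x => (h.space_p t x).continuousAt,
    fun x => continuous_iff_continuousAt.2 fun t => (h.time_p t x).continuousAt,
    fun _ => ⟨1, Eventually.of_forall h.norm_p_le⟩⟩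

lemma isBoundedCoeff_k (h : IsDarbouxPair q q' p k) : IsBoundedCoeff k :=
  ⟨fun t => continuous_iff_continuousAt.2 fun x => (h.space_k t x).continuousAt,
    h.continuous_time_k, fun _ => ⟨1, Eventually.of_forall h.norm_k_le⟩⟩

lemma continuousInL2_p (h : IsDarbouxPair q q' p k) (hq : RegularSolution q q' q'')
    (hp : LocallyBoundedInL2 p) : ContinuousInL2 p := by
  have bp := h.isBoundedCoeff_p
  have bk := h.isBoundedCoeff_k
  have bq := hq.c0.isBoundedCoeff
  have bI := IsBoundedCoeff.const Complex.I
  have bcoeff := ((IsBoundedCoeff.const 1).add ((IsBoundedCoeff.const 2).mul (bq.mul bq.star))).add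
    ((IsBoundedCoeff.const 2).mul ((bq.star.mul bp).sub (bq.mul bp.star)))
  have bderiv := bI.mul (((bcoeff.mul bp).add bq).sub (bk.mul hq.c0'.isBoundedCoeff))
  exact .of_hasDerivAt_time hp.memLp h.time_p bderiv.continuous_time bderiv.continuous_space
    (.mul_left bI (((hp.mul_left bcoeff).add hq.l2.locallyBoundedInL2).sub
      (hq.l2'.locallyBoundedInL2.mul_left bk)))

lemma isBoundedCoeff_offDiagDeriv₁ (h : IsDarbouxPair q q' p k) (hq : RegularSolution q q' q'') :
    IsBoundedCoeff (offDiagDeriv₁ q p k) :=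
  (h.isBoundedCoeff_k.mul (hq.c0.isBoundedCoeff.add h.isBoundedCoeff_p)).neg

lemma isBoundedCoeff_diagDeriv₁ (h : IsDarbouxPair q q' p k) (hq : RegularSolution q q' q'') :
    IsBoundedCoeff (diagDeriv₁ q p) := by
  have bp := h.isBoundedCoeff_p
  have bq := hq.c0.isBoundedCoeff
  exact ((IsBoundedCoeff.const 4).mul (bp.mul bp.star)).add
    ((IsBoundedCoeff.const 2).mul ((bq.star.mul bp).add (bq.mul bp.star)))

lemma isBoundedCoeff_offDiagDeriv₂ (h : IsDarbouxPair q q' p k) (hq : RegularSolution q q' q'') :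
    IsBoundedCoeff (offDiagDeriv₂ q q' p k) :=
  (((h.isBoundedCoeff_diagDeriv₁ hq).mul (hq.c0.isBoundedCoeff.add h.isBoundedCoeff_p)).add
    (h.isBoundedCoeff_k.mul
      (hq.c0'.isBoundedCoeff.add (h.isBoundedCoeff_offDiagDeriv₁ hq)))).neg

lemma isBoundedCoeff_diagDeriv₂ (h : IsDarbouxPair q q' p k) (hq : RegularSolution q q' q'') :
    IsBoundedCoeff (diagDeriv₂ q q' p k) := by
  have bp := h.isBoundedCoeff_p
  have bp₁ := h.isBoundedCoeff_offDiagDeriv₁ hq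
  have bq := hq.c0.isBoundedCoeff
  have bq' := hq.c0'.isBoundedCoeff
  exact ((IsBoundedCoeff.const 4).mul ((bp₁.mul bp.star).add (bp.mul bp₁.star))).add
    ((IsBoundedCoeff.const 2).mul
      (((bq'.star.mul bp).add (bq.star.mul bp₁)).add ((bq'.mul bp.star).add (bq.mul bp₁.star))))

lemma continuous_offDiagDeriv₃ (h : IsDarbouxPair q q' p k) (hq : RegularSolution q q' q'')
    (t : ℝ) : Continuous (offDiagDeriv₃ q q' q'' p k t) := by
  have bsum₁ := hq.c0'.isBoundedCoeff.add (h.isBoundedCoeff_offDiagDeriv₁ hq)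
  have bk₁ := h.isBoundedCoeff_diagDeriv₁ hq
  exact ((((h.isBoundedCoeff_diagDeriv₂ hq).mul (hq.c0.isBoundedCoeff.add h.isBoundedCoeff_p)).add
    (bk₁.mul bsum₁)).add ((bk₁.mul bsum₁).add (h.isBoundedCoeff_k.mul
      (hq.c0''.isBoundedCoeff.add (h.isBoundedCoeff_offDiagDeriv₂ hq))))).neg.continuous_space t

lemma continuousInL2_offDiagDeriv₁ (h : IsDarbouxPair q q' p k) (hq : RegularSolution q q' q'')
    (hp : ContinuousInL2 p) : ContinuousInL2 (offDiagDeriv₁ q p k) :=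
  (ContinuousInL2.mul_left h.isBoundedCoeff_k (hq.l2.add hp)).neg

lemma continuousInL2_offDiagDeriv₂ (h : IsDarbouxPair q q' p k) (hq : RegularSolution q q' q'')
    (hp : ContinuousInL2 p) : ContinuousInL2 (offDiagDeriv₂ q q' p k) :=
  (((hq.l2.add hp).mul_left (h.isBoundedCoeff_diagDeriv₁ hq)).add
    ((hq.l2'.add (h.continuousInL2_offDiagDeriv₁ hq hp)).mul_left h.isBoundedCoeff_k)).neg

lemma continuousInL2_offDiagDeriv₃ (h : IsDarbouxPair q q' p k) (hq : RegularSolution q q' q'')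
    (hp : ContinuousInL2 p) : ContinuousInL2 (offDiagDeriv₃ q q' q'' p k) := by
  have hmid := (hq.l2'.add (h.continuousInL2_offDiagDeriv₁ hq hp)).mul_left
    (h.isBoundedCoeff_diagDeriv₁ hq)
  exact ((((hq.l2.add hp).mul_left (h.isBoundedCoeff_diagDeriv₂ hq)).add hmid).add
    (hmid.add ((hq.l2''.add (h.continuousInL2_offDiagDeriv₂ hq hp)).mul_left
      h.isBoundedCoeff_k))).neg

lemma isH3SolutionNLS (h : IsDarbouxPair q q' p k) (hq : RegularSolution q q' q'')
    {q₃ : ℝ → ℝ → ℂ} (hq₃ : ContinuousInL2 q₃) (hw : ∀ t, IsWeakDeriv (q'' t) (q₃ t))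
    (hp : ContinuousInL2 p) : IsH3SolutionNLS fun t x => -q t x - 2 * p t x := by
  have bp₁ := h.isBoundedCoeff_offDiagDeriv₁ hq
  have bp₂ := h.isBoundedCoeff_offDiagDeriv₂ hq
  have hcomb {f g : ℝ → ℝ → ℂ} (hf : ContinuousInL2 f) (hg : ContinuousInL2 g) :
      ContinuousInL2 fun t x => -f t x - 2 * g t x := hf.neg.sub (hg.mul_left (.const 2))
  have hweak {f f' g g' : ℝ → ℂ} (hf : IsWeakDeriv f f') (hg : ∀ x, HasDerivAt g (g' x) x)
      (hg' : Continuous g') : IsWeakDeriv (fun x => -f x - 2 * g x) fun x => -f' x - 2 * g' x :=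
    hf.neg.sub (.of_hasDerivAt (fun x => (hg x).const_mul 2) (continuous_const.mul hg'))
  have hcont (t : ℝ) : Continuous fun x => -q t x - 2 * p t x :=
    (hq.c0.continuous t).neg.sub (continuous_const.mul (h.isBoundedCoeff_p.continuous_space t))
  refine ⟨continuousInSobolev_three hcont (hcomb hq.l2 hp)
    (hcomb hq.l2' (h.continuousInL2_offDiagDeriv₁ hq hp))
    (hcomb hq.l2'' (h.continuousInL2_offDiagDeriv₂ hq hp))
    (hcomb hq₃ (h.continuousInL2_offDiagDeriv₃ hq hp)) (fun t => ?_) (fun t => ?_) (fun t => ?_),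
    fun t x => (h.hasDerivAt_time hq t x).differentiableAt, h.equation hq⟩
  · exact hweak (.of_hasDerivAt (hq.hasDerivAt t) (hq.c0'.continuous t)) (h.space_p t)
      (bp₁.continuous_space t)
  · exact hweak (.of_hasDerivAt (hq.hasDerivAt' t) (hq.c0''.continuous t))
      (h.hasDerivAt_offDiagDeriv₁ hq t) (bp₂.continuous_space t)
  · exact hweak (hw t) (h.hasDerivAt_offDiagDeriv₂ hq t) (h.continuous_offDiagDeriv₃ hq t)

end IsDarbouxPair

/-! ### Distance of the Bäcklund transform to the soliton -/

lemma mul_conj_add_mul_conj_eq (u v : ℂ) :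
    u * conj u + v * conj v = ((‖u‖ ^ 2 + ‖v‖ ^ 2 : ℝ) : ℂ) := by
  rw [Complex.mul_conj', Complex.mul_conj']
  push_cast
  rfl

lemma projOffDiag_const_mul {a : ℂ} (ha : a ≠ 0) (u v : ℂ) :
    projOffDiag (a * u) (a * v) = projOffDiag u v := by
  have hN : a * u * conj (a * u) + a * v * conj (a * v)
      = (a * conj a) * (u * conj u + v * conj v) := by
    simp only [map_mul]
    ring
  rw [projOffDiag, projOffDiag, hN, map_mul, mul_mul_mul_comm,
    mul_div_mul_left _ _ (mul_ne_zero ha ((map_ne_zero _).2 ha))]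

lemma backlund_eq (q ψ₁ ψ₂ : ℝ → ℝ → ℂ) :
    backlund q ψ₁ ψ₂ = fun t x => -q t x - 2 * projOffDiag (ψ₁ t x) (ψ₂ t x) := by
  ext t x
  rw [backlund, projOffDiag, mul_conj_add_mul_conj_eq, mul_assoc, mul_div_assoc]

/-- The right-hand side is the sine of the angle between the lines spanned by `(u, v)` and
`(u', v')`. -/
lemma norm_projOffDiag_sub_le {u v u' v' : ℂ} (h : u ≠ 0 ∨ v ≠ 0) (h' : u' ≠ 0 ∨ v' ≠ 0) :
    ‖projOffDiag u v - projOffDiag u' v'‖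
      ≤ ‖u * v' - v * u'‖ / √((‖u‖ ^ 2 + ‖v‖ ^ 2) * (‖u'‖ ^ 2 + ‖v'‖ ^ 2)) := by
  have hN := mul_conj_add_mul_conj_ne_zero h
  have hN' := mul_conj_add_mul_conj_ne_zero h'
  set w := u * v' - v * u' with hw
  set M := (‖u‖ ^ 2 + ‖v‖ ^ 2) * (‖u'‖ ^ 2 + ‖v'‖ ^ 2) with hM
  have hMnonneg : 0 ≤ M := by positivity
  have hdiff : projOffDiag u v - projOffDiag u' v'
      = (conj v * conj v' * w - u * u' * conj w) / (M : ℂ) := by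
    rw [hM, Complex.ofReal_mul, ← mul_conj_add_mul_conj_eq, ← mul_conj_add_mul_conj_eq,
      projOffDiag, projOffDiag, div_sub_div _ _ hN hN', hw]
    simp only [map_sub, map_mul]
    ring
  have hcauchySchwarz : ‖v‖ * ‖v'‖ + ‖u‖ * ‖u'‖ ≤ √M :=
    Real.le_sqrt_of_sq_le (by nlinarith [sq_nonneg (‖u‖ * ‖v'‖ - ‖v‖ * ‖u'‖)])
  have hnum : ‖conj v * conj v' * w - u * u' * conj w‖ ≤ ‖w‖ * √M := by
    refine (norm_sub_le _ _).trans ?_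
    simp only [norm_mul, RCLike.norm_conj]
    nlinarith [norm_nonneg w]
  calc ‖projOffDiag u v - projOffDiag u' v'‖
      = ‖conj v * conj v' * w - u * u' * conj w‖ / M := by
        rw [hdiff, norm_div, Complex.norm_of_nonneg hMnonneg]
    _ ≤ ‖w‖ * √M / M := by gcongr
    _ = ‖w‖ / √M := by rw [mul_div_assoc, Real.sqrt_div_self, div_eq_mul_inv]

/-- The combination `e^z f + e^{-z} c` of one component of the two Jost solutions. -/
def expComb (z f c : ℂ) : ℂ := Complex.exp z * f + Complex.exp (-z) * c

lemma norm_exp_sq (z : ℂ) : ‖Complex.exp z‖ ^ 2 = Real.exp (2 * z.re) := by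
  rw [Complex.norm_exp, ← Real.exp_nat_mul, Nat.cast_ofNat]

lemma normSq_exp_add_normSq_exp_neg (z : ℂ) :
    ‖Complex.exp z‖ ^ 2 + ‖-Complex.exp (-z)‖ ^ 2 = 2 * Real.cosh (2 * z.re) := by
  rw [norm_neg, norm_exp_sq, norm_exp_sq, Real.cosh_eq, Complex.neg_re, mul_neg]
  ring

lemma two_mul_projOffDiag_exp (z : ℂ) : 2 * projOffDiag (Complex.exp z) (-Complex.exp (-z))
    = -(Complex.exp (2 * z.im * Complex.I) * sech (2 * z.re)) := by
  have hphase : Complex.exp z * conj (Complex.exp (-z)) = Complex.exp (2 * z.im * Complex.I) := by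
    rw [← Complex.exp_conj, ← Complex.exp_add, map_neg, ← sub_eq_add_neg, Complex.sub_conj]
    push_cast
    rfl
  have hcosh : (Real.cosh (2 * z.re) : ℂ) ≠ 0 := Complex.ofReal_ne_zero.2 (Real.cosh_pos _).ne'
  rw [projOffDiag, mul_conj_add_mul_conj_eq, normSq_exp_add_normSq_exp_neg, map_neg, mul_neg,
    hphase, sech]
  push_cast at hcosh ⊢
  field_simp

section Perturbation

variable {z f₁ f₂ c₁ c₂ : ℂ}

lemma normSq_expComb_le {f c : ℂ} {κ : ℝ} (hf : ‖f‖ ≤ κ) (hc : ‖c‖ ≤ κ) :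
    ‖expComb z f c‖ ^ 2 ≤ 4 * κ ^ 2 * Real.cosh (2 * z.re) := by
  have hnorm : ‖expComb z f c‖ ≤ ‖Complex.exp z‖ * κ + ‖Complex.exp (-z)‖ * κ :=
    norm_add_le_of_le (norm_mul_le_of_le le_rfl hf) (norm_mul_le_of_le le_rfl hc)
  have hsum := normSq_exp_add_normSq_exp_neg z
  rw [norm_neg] at hsum
  calc ‖expComb z f c‖ ^ 2 ≤ (‖Complex.exp z‖ * κ + ‖Complex.exp (-z)‖ * κ) ^ 2 := by gcongr
    _ ≤ 2 * κ ^ 2 * (‖Complex.exp z‖ ^ 2 + ‖Complex.exp (-z)‖ ^ 2) := by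
        nlinarith [sq_nonneg (‖Complex.exp z‖ * κ - ‖Complex.exp (-z)‖ * κ)]
    _ = 4 * κ ^ 2 * Real.cosh (2 * z.re) := by rw [hsum]; ring

lemma cosh_le_normSq_expComb {κ : ℝ} (hκ : κ ≤ 1 / 7) (hf₁ : ‖f₁ - 1‖ ≤ κ) (hf₂ : ‖f₂‖ ≤ κ)
    (hc₁ : ‖c₁‖ ≤ κ) (hc₂ : ‖c₂ + 1‖ ≤ κ) :
    Real.cosh (2 * z.re) ≤ ‖expComb z f₁ c₁‖ ^ 2 + ‖expComb z f₂ c₂‖ ^ 2 := by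
  have hκ0 : 0 ≤ κ := (norm_nonneg _).trans hf₂
  have hκsq : κ ^ 2 ≤ 1 / 49 := by nlinarith
  have hsq {a b : ℂ} : ‖a‖ ^ 2 ≤ 3 / 2 * ‖a + b‖ ^ 2 + 3 * ‖b‖ ^ 2 := by
    have htriangle : ‖a‖ ≤ ‖a + b‖ + ‖b‖ := norm_le_add_norm_add a b
    nlinarith [norm_nonneg a, sq_nonneg (‖a + b‖ - 2 * ‖b‖)]
  have h₁ : expComb z f₁ c₁ = Complex.exp z + expComb z (f₁ - 1) c₁ := by
    simp only [expComb]
    ring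
  have h₂ : expComb z f₂ c₂ = -Complex.exp (-z) + expComb z f₂ (c₂ + 1) := by
    simp only [expComb]
    ring
  have hsum := normSq_exp_add_normSq_exp_neg z
  have hexp₁ := hsq (a := Complex.exp z) (b := expComb z (f₁ - 1) c₁)
  have hexp₂ := hsq (a := -Complex.exp (-z)) (b := expComb z f₂ (c₂ + 1))
  rw [← h₁] at hexp₁
  rw [← h₂] at hexp₂
  nlinarith [normSq_expComb_le (z := z) hf₁ hc₁,
    normSq_expComb_le (z := z) hf₂ hc₂, Real.cosh_pos (2 * z.re)]

lemma expComb_ne_zero_or {κ : ℝ} (hκ : κ ≤ 1 / 7) (hf₁ : ‖f₁ - 1‖ ≤ κ) (hf₂ : ‖f₂‖ ≤ κ)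
    (hc₁ : ‖c₁‖ ≤ κ) (hc₂ : ‖c₂ + 1‖ ≤ κ) : expComb z f₁ c₁ ≠ 0 ∨ expComb z f₂ c₂ ≠ 0 := by
  by_contra! hzero
  have hN := cosh_le_normSq_expComb (z := z) hκ hf₁ hf₂ hc₁ hc₂
  rw [hzero.1, hzero.2, norm_zero, zero_pow two_ne_zero, add_zero] at hN
  exact hN.not_gt (Real.cosh_pos _)

/-- Since `f₁ ≈ 1` and `c₂ ≈ -1` only uniformly, while `f₂` and `c₁` are square integrable, only the
latter may be multiplied by `cosh`. -/
lemma norm_det_expComb_le :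
    ‖expComb z f₁ c₁ * -Complex.exp (-z) - expComb z f₂ c₂ * Complex.exp z‖
      ≤ ‖f₁ - 1‖ + ‖c₂ + 1‖ + 2 * (‖f₂‖ + ‖c₁‖) * Real.cosh (2 * z.re) := by
  have hexp : Complex.exp z * Complex.exp (-z) = 1 := by rw [← Complex.exp_add]; simp
  have hdet : expComb z f₁ c₁ * -Complex.exp (-z) - expComb z f₂ c₂ * Complex.exp z
      = -((f₁ - 1) + (c₂ + 1) + Complex.exp (-z) ^ 2 * c₁ + Complex.exp z ^ 2 * f₂) := by
    simp only [expComb]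
    linear_combination -(f₁ + c₂) * hexp
  have hsum := normSq_exp_add_normSq_exp_neg z
  rw [norm_neg] at hsum
  rw [hdet, norm_neg]
  refine (norm_add_le_of_le (norm_add_le_of_le (norm_add_le _ _) (norm_mul_le _ _))
    (norm_mul_le _ _)).trans ?_
  have hcosh : 2 * (‖f₂‖ + ‖c₁‖) * Real.cosh (2 * z.re)
      = (‖f₂‖ + ‖c₁‖) * (‖Complex.exp z‖ ^ 2 + ‖Complex.exp (-z)‖ ^ 2) := by
    rw [hsum]
    ring
  rw [norm_pow, norm_pow, hcosh]
  nlinarith [mul_nonneg (sq_nonneg ‖Complex.exp z‖) (norm_nonneg c₁),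
    mul_nonneg (sq_nonneg ‖Complex.exp (-z)‖) (norm_nonneg f₂)]

lemma norm_two_mul_projOffDiag_add_soliton_le {κ : ℝ} (hκ : κ ≤ 1 / 7) (hf₁ : ‖f₁ - 1‖ ≤ κ)
    (hf₂ : ‖f₂‖ ≤ κ) (hc₁ : ‖c₁‖ ≤ κ) (hc₂ : ‖c₂ + 1‖ ≤ κ) :
    ‖2 * projOffDiag (expComb z f₁ c₁) (expComb z f₂ c₂)
        + Complex.exp (2 * z.im * Complex.I) * sech (2 * z.re)‖
      ≤ 2 * (‖f₁ - 1‖ + ‖c₂ + 1‖) * sech (2 * z.re) + 4 * (‖f₂‖ + ‖c₁‖) := by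
  have hcosh := Real.cosh_pos (2 * z.re)
  have hN := cosh_le_normSq_expComb (z := z) hκ hf₁ hf₂ hc₁ hc₂
  have hne := expComb_ne_zero_or (z := z) hκ hf₁ hf₂ hc₁ hc₂
  have hsqrt : Real.cosh (2 * z.re) ≤ √((‖expComb z f₁ c₁‖ ^ 2 + ‖expComb z f₂ c₂‖ ^ 2)
      * (‖Complex.exp z‖ ^ 2 + ‖-Complex.exp (-z)‖ ^ 2)) := by
    rw [normSq_exp_add_normSq_exp_neg]
    exact Real.le_sqrt_of_sq_le (by nlinarith)
  rw [← neg_neg (Complex.exp (2 * z.im * Complex.I) * _), ← two_mul_projOffDiag_exp,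
    ← sub_eq_add_neg, ← mul_sub, norm_mul, Complex.norm_ofNat]
  calc 2 * ‖projOffDiag (expComb z f₁ c₁) (expComb z f₂ c₂)
        - projOffDiag (Complex.exp z) (-Complex.exp (-z))‖
      ≤ 2 * ((‖f₁ - 1‖ + ‖c₂ + 1‖ + 2 * (‖f₂‖ + ‖c₁‖) * Real.cosh (2 * z.re))
          / Real.cosh (2 * z.re)) := by
        gcongr
        exact (norm_projOffDiag_sub_le hne (Or.inl (Complex.exp_ne_zero z))).trans
          (div_le_div₀ (by positivity) norm_det_expComb_le hcosh hsqrt)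
    _ = 2 * (‖f₁ - 1‖ + ‖c₂ + 1‖) * sech (2 * z.re) + 4 * (‖f₂‖ + ‖c₁‖) := by
        rw [sech]
        field_simp
        ring

end Perturbation

/-! ### Square integrable bounds -/

lemma sech_nonneg (x : ℝ) : 0 ≤ sech x :=
  one_div_nonneg.2 (Real.cosh_pos x).le

lemma continuous_sech : Continuous sech :=
  continuous_const.div Real.continuous_cosh fun x => (Real.cosh_pos x).ne'

lemma memLp_sech : MemLp sech 2 := by
  rw [memLp_two_iff_integrable_sq continuous_sech.aestronglyMeasurable]
  refine integrable_inv_one_add_sq.mono' (continuous_sech.pow 2).aestronglyMeasurable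
    (ae_of_all _ fun x => ?_)
  have hsinh : x ^ 2 ≤ Real.sinh x ^ 2 := by
    rw [sq_le_sq, Real.abs_sinh]
    exact Real.self_le_sinh_iff.2 (abs_nonneg x)
  rw [Real.norm_of_nonneg (sq_nonneg _), sech, div_pow, one_pow, one_div, Real.cosh_sq']
  gcongr

lemma eLpNorm_sech_add (γ : ℝ) : eLpNorm (fun x => sech (x + γ)) 2 = eLpNorm sech 2 :=
  eLpNorm_comp_measurePreserving continuous_sech.aestronglyMeasurable
    (measurePreserving_add_right volume γ)

/-- The soliton `e^{iτ} sech(x + γ)`; at time `t` the phase is `τ = t + θ`. -/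
def soliton (γ τ x : ℝ) : ℂ := Complex.exp (Complex.I * τ) * sech (x + γ)

lemma continuous_soliton (γ τ : ℝ) : Continuous (soliton γ τ) :=
  continuous_const.mul (Complex.continuous_ofReal.comp
    (continuous_sech.comp (continuous_add_const γ)))

lemma eLpNorm_soliton (γ τ : ℝ) : eLpNorm (soliton γ τ) 2 = eLpNorm sech 2 := by
  rw [← eLpNorm_sech_add γ]
  refine eLpNorm_congr_norm_ae (ae_of_all _ fun x => ?_)
  rw [soliton, norm_mul, Complex.norm_exp_I_mul_ofReal, one_mul, Complex.norm_real]

lemma toReal_eLpNorm_two_sq {α E : Type*} [MeasurableSpace α] {μ : Measure α}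
    [NormedAddCommGroup E] {f : α → E} (hf : MemLp f 2 μ) :
    (eLpNorm f 2 μ).toReal ^ 2 = ∫ x, ‖f x‖ ^ 2 ∂μ := by
  rw [← ENNReal.toReal_pow, eLpNorm_two_sq, integral_eq_lintegral_of_nonneg_ae
    (ae_of_all _ fun x => sq_nonneg ‖f x‖) (hf.1.norm.pow 2)]
  congr 1
  refine lintegral_congr fun x => ?_
  rw [ENNReal.ofReal_pow (norm_nonneg _), ofReal_norm]

lemma HasL2Bound.eLpNorm_le {E : Type*} [NormedAddCommGroup E] {f : ℝ → E} {δ : ℝ}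
    (h : HasL2Bound f δ) : eLpNorm f 2 ≤ ENNReal.ofReal δ := by
  rw [← ENNReal.ofReal_toReal h.memLp.eLpNorm_ne_top]
  refine ENNReal.ofReal_le_ofReal ((sq_le_sq₀ ENNReal.toReal_nonneg h.nonneg).1 ?_)
  exact (toReal_eLpNorm_two_sq h.memLp).trans_le h.integral_le

lemma RegularSolution.hasL2Bound {q q' q'' : ℝ → ℝ → ℂ} (hq : RegularSolution q q' q'') (t : ℝ) :
    HasL2Bound (q t) (eLpNorm (q 0) 2).toReal where
  continuous := hq.c0.continuous t
  nonneg := ENNReal.toReal_nonneg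
  memLp := hq.l2.memLp t
  integral_le := by rw [hq.integral_normSq_eq, toReal_eLpNorm_two_sq (hq.l2.memLp 0)]

namespace IsJostChi

variable {q χ₁ χ₂ : ℝ → ℂ} {δ : ℝ}

lemma norm_fst_le (h : IsJostChi q χ₁ χ₂) (hq : HasL2Bound q δ) (hδ : δ ^ 2 ≤ 1 / 8) (x : ℝ) :
    ‖χ₁ x‖ ≤ 8 * δ := by
  simpa only [neg_neg] using h.isJostPhi_reflect.norm_snd_le hq.neg_conj_comp_neg hδ (-x)

lemma hasL2Bound_fst (h : IsJostChi q χ₁ χ₂) (hq : HasL2Bound q δ) (hδ : δ ^ 2 ≤ 1 / 8) :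
    HasL2Bound χ₁ (9 * δ) :=
  (h.isJostPhi_reflect.hasL2Bound_snd hq.neg_conj_comp_neg hδ).of_norm_eq_comp_neg
    (continuous_iff_continuousAt.2 fun x => (h.hasDerivAt_fst x).continuousAt)
    fun x => by rw [neg_neg]

lemma norm_snd_add_one_le (h : IsJostChi q χ₁ χ₂) (hq : HasL2Bound q δ) (hδ : δ ^ 2 ≤ 1 / 8)
    (x : ℝ) : ‖χ₂ x + 1‖ ≤ 9 * δ ^ 2 := by
  rw [← norm_neg, neg_add, ← sub_eq_add_neg]
  simpa only [neg_neg] using h.isJostPhi_reflect.norm_fst_sub_one_le hq.neg_conj_comp_neg hδ (-x)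

end IsJostChi

/-- The two Jost solutions of one potential `q` of small `L²` norm. The constant `1 / 100` leaves
room in all the smallness requirements on `δ`. -/
structure IsJostPair (q f₁ f₂ c₁ c₂ : ℝ → ℂ) (δ : ℝ) : Prop where
  phi : IsJostPhi q f₁ f₂
  chi : IsJostChi q c₁ c₂
  hasL2Bound : HasL2Bound q δ
  le : δ ≤ 1 / 100

/-- The complex number `z` for which `e^z` and `e^{-z}` are the coefficients of the two Jost
solutions in the superposition, up to a common factor. -/
def solitonPhase (γ τ x : ℝ) : ℂ := ((x + γ : ℝ) + τ * Complex.I) / 2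

lemma two_mul_re_solitonPhase (γ τ x : ℝ) : 2 * (solitonPhase γ τ x).re = x + γ := by
  rw [solitonPhase, ← Complex.mk_eq_add_mul_I, Complex.div_ofNat_re]
  ring

lemma two_mul_im_solitonPhase (γ τ x : ℝ) : 2 * (solitonPhase γ τ x).im = τ := by
  rw [solitonPhase, ← Complex.mk_eq_add_mul_I, Complex.div_ofNat_im]
  ring

lemma hasDerivAt_solitonPhase (γ τ x : ℝ) : HasDerivAt (solitonPhase γ τ) (1 / 2) x :=
  (((((hasDerivAt_id x).add_const γ).ofReal_comp).add_const _).div_const 2).congr_deriv (by simp)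

namespace IsJostPair

variable {q f₁ f₂ c₁ c₂ : ℝ → ℂ} {δ : ℝ}

lemma sq_le (h : IsJostPair q f₁ f₂ c₁ c₂ δ) : δ ^ 2 ≤ 1 / 8 := by
  nlinarith [h.le, h.hasL2Bound.nonneg]

lemma norm_le (h : IsJostPair q f₁ f₂ c₁ c₂ δ) (x : ℝ) :
    ‖f₁ x - 1‖ ≤ 8 * δ ∧ ‖f₂ x‖ ≤ 8 * δ ∧ ‖c₁ x‖ ≤ 8 * δ ∧ ‖c₂ x + 1‖ ≤ 8 * δ := by
  have hsmall : 9 * δ ^ 2 ≤ 8 * δ := by nlinarith [h.le, h.hasL2Bound.nonneg]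
  exact ⟨(h.phi.norm_fst_sub_one_le h.hasL2Bound h.sq_le x).trans hsmall,
    h.phi.norm_snd_le h.hasL2Bound h.sq_le x, h.chi.norm_fst_le h.hasL2Bound h.sq_le x,
    (h.chi.norm_snd_add_one_le h.hasL2Bound h.sq_le x).trans hsmall⟩

lemma expComb_ne_zero (h : IsJostPair q f₁ f₂ c₁ c₂ δ) (z : ℂ) (x : ℝ) :
    expComb z (f₁ x) (c₁ x) ≠ 0 ∨ expComb z (f₂ x) (c₂ x) ≠ 0 := by
  obtain ⟨hf₁, hf₂, hc₁, hc₂⟩ := h.norm_le x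
  exact expComb_ne_zero_or (by linarith [h.le]) hf₁ hf₂ hc₁ hc₂

lemma hasDerivAt_expComb (h : IsJostPair q f₁ f₂ c₁ c₂ δ) (γ τ x : ℝ) :
    HasDerivAt (fun y => expComb (solitonPhase γ τ y) (f₁ y) (c₁ y))
      (1 / 2 * expComb (solitonPhase γ τ x) (f₁ x) (c₁ x)
        + q x * expComb (solitonPhase γ τ x) (f₂ x) (c₂ x)) x ∧
    HasDerivAt (fun y => expComb (solitonPhase γ τ y) (f₂ y) (c₂ y))
      (-conj (q x) * expComb (solitonPhase γ τ x) (f₁ x) (c₁ x)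
        - 1 / 2 * expComb (solitonPhase γ τ x) (f₂ x) (c₂ x)) x := by
  have hz := hasDerivAt_solitonPhase γ τ x
  constructor
  · refine ((hz.cexp.mul (h.phi.hasDerivAt_fst x)).add
      (hz.neg.cexp.mul (h.chi.hasDerivAt_fst x))).congr_deriv ?_
    simp only [expComb, Pi.neg_apply]
    ring
  · refine ((hz.cexp.mul (h.phi.hasDerivAt_snd x)).add
      (hz.neg.cexp.mul (h.chi.hasDerivAt_snd x))).congr_deriv ?_
    simp only [expComb, Pi.neg_apply]
    ring

lemma norm_two_mul_projOffDiag_add_soliton_le (h : IsJostPair q f₁ f₂ c₁ c₂ δ) (γ τ x : ℝ) :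
    ‖2 * projOffDiag (expComb (solitonPhase γ τ x) (f₁ x) (c₁ x))
        (expComb (solitonPhase γ τ x) (f₂ x) (c₂ x)) + soliton γ τ x‖
      ≤ 32 * δ * sech (x + γ) + 4 * (‖f₂ x‖ + ‖c₁ x‖) := by
  obtain ⟨hf₁, hf₂, hc₁, hc₂⟩ := h.norm_le x
  have hpointwise := BacklundNLS.norm_two_mul_projOffDiag_add_soliton_le
    (z := solitonPhase γ τ x) (by linarith [h.le]) hf₁ hf₂ hc₁ hc₂
  rw [← Complex.ofReal_ofNat, ← Complex.ofReal_mul, two_mul_re_solitonPhase,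
    two_mul_im_solitonPhase, mul_comm (τ : ℂ)] at hpointwise
  have hcoeff : 2 * (‖f₁ x - 1‖ + ‖c₂ x + 1‖) ≤ 32 * δ := by linarith
  exact hpointwise.trans (by gcongr; exact sech_nonneg _)

lemma eLpNorm_two_mul_projOffDiag_add_soliton_le (h : IsJostPair q f₁ f₂ c₁ c₂ δ) (γ τ : ℝ) :
    eLpNorm (fun x => 2 * projOffDiag (expComb (solitonPhase γ τ x) (f₁ x) (c₁ x))
        (expComb (solitonPhase γ τ x) (f₂ x) (c₂ x)) + soliton γ τ x) 2 volume
      ≤ (72 + 32 * eLpNorm sech 2 volume) * ENNReal.ofReal δ := by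
  have hδ := h.hasL2Bound.nonneg
  have hf₂ := h.phi.hasL2Bound_snd h.hasL2Bound h.sq_le
  have hc₁ := h.chi.hasL2Bound_fst h.hasL2Bound h.sq_le
  have hsech : AEStronglyMeasurable (fun x => sech (x + γ)) volume :=
    (continuous_sech.comp (continuous_add_const γ)).aestronglyMeasurable
  calc eLpNorm (fun x => 2 * projOffDiag (expComb (solitonPhase γ τ x) (f₁ x) (c₁ x))
        (expComb (solitonPhase γ τ x) (f₂ x) (c₂ x)) + soliton γ τ x) 2 volume
      ≤ eLpNorm ((32 * δ) • (fun x => sech (x + γ))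
          + (4 : ℝ) • ((fun x => ‖f₂ x‖) + fun x => ‖c₁ x‖)) 2 volume :=
        eLpNorm_mono_real (h.norm_two_mul_projOffDiag_add_soliton_le γ τ)
    _ ≤ eLpNorm ((32 * δ) • fun x => sech (x + γ)) 2 volume
          + eLpNorm ((4 : ℝ) • ((fun x => ‖f₂ x‖) + fun x => ‖c₁ x‖)) 2 volume :=
        eLpNorm_add_le (hsech.const_smul _)
          ((hf₂.memLp.1.norm.add hc₁.memLp.1.norm).const_smul _) one_le_two
    _ ≤ ENNReal.ofReal (32 * δ) * eLpNorm sech 2 volume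
          + ENNReal.ofReal 4 * (ENNReal.ofReal (9 * δ) + ENNReal.ofReal (9 * δ)) := by
        rw [eLpNorm_const_smul, eLpNorm_const_smul, eLpNorm_sech_add,
          Real.enorm_of_nonneg (by positivity), Real.enorm_of_nonneg (by norm_num)]
        gcongr
        refine (eLpNorm_add_le hf₂.memLp.1.norm hc₁.memLp.1.norm one_le_two).trans ?_
        rw [eLpNorm_norm, eLpNorm_norm]
        exact add_le_add hf₂.eLpNorm_le hc₁.eLpNorm_le
    _ = (72 + 32 * eLpNorm sech 2 volume) * ENNReal.ofReal δ := by
        rw [ENNReal.ofReal_mul (by norm_num), ENNReal.ofReal_mul (by norm_num)]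
        simp only [ENNReal.ofReal_ofNat]
        ring

end IsJostPair

/-! ### The Bäcklund transform of a small solution -/

/-- The vector functions `φ` and `χ` solve the time equation of the Lax pair and, up to the phases
`e^{∓it/2}`, are at every time `t` the Jost solutions of the small potential `q t`. -/
structure IsJostFlow (q φ₁ φ₂ χ₁ χ₂ : ℝ → ℝ → ℂ) (δ : ℝ) : Prop where
  lax_phi : SolvesLaxTime q φ₁ φ₂
  lax_chi : SolvesLaxTime q χ₁ χ₂
  pair : ∀ t, IsJostPair (q t)
    (fun x => Complex.exp (-(Complex.I * t / 2)) * φ₁ t x)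
    (fun x => Complex.exp (-(Complex.I * t / 2)) * φ₂ t x)
    (fun x => Complex.exp (Complex.I * t / 2) * χ₁ t x)
    (fun x => Complex.exp (Complex.I * t / 2) * χ₂ t x) δ

lemma RegularSolution.isJostFlow {q q' q'' φ₁ φ₂ χ₁ χ₂ : ℝ → ℝ → ℂ}
    (hq : RegularSolution q q' q'') (hsmall : (eLpNorm (q 0) 2).toReal ≤ 1 / 100)
    (hφ : IsJostPhi (q 0) (φ₁ 0) (φ₂ 0)) (hφlax : SolvesLaxTime q φ₁ φ₂)
    (hχ : IsJostChi (q 0) (χ₁ 0) (χ₂ 0)) (hχlax : SolvesLaxTime q χ₁ χ₂) :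
    IsJostFlow q φ₁ φ₂ χ₁ χ₂ (eLpNorm (q 0) 2).toReal := by
  have hsq : (eLpNorm (q 0) 2).toReal ^ 2 ≤ 1 / 8 := by
    nlinarith [ENNReal.toReal_nonneg (a := eLpNorm (q 0) 2)]
  exact ⟨hφlax, hχlax, fun t => ⟨hq.isJostPhi (hq.hasL2Bound 0) hsq hφ hφlax t,
    hq.isJostChi (hq.hasL2Bound 0) hsq hχ hχlax t, hq.hasL2Bound t, hsmall⟩⟩

lemma superpose_eq (a : ℂ) (γ θ : ℝ) (φ χ : ℝ → ℝ → ℂ) (t x : ℝ) :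
    superpose a γ θ φ χ t x = a * expComb (solitonPhase γ (t + θ) x)
      (Complex.exp (-(Complex.I * t / 2)) * φ t x) (Complex.exp (Complex.I * t / 2) * χ t x) := by
  have hφ : Complex.exp (solitonPhase γ (t + θ) x) * Complex.exp (-(Complex.I * t / 2))
      = Complex.exp ((γ + Complex.I * θ) / 2) * Real.exp (x / 2) := by
    rw [Complex.ofReal_exp, ← Complex.exp_add, ← Complex.exp_add, solitonPhase]
    push_cast
    ring_nf
  have hχ : Complex.exp (-solitonPhase γ (t + θ) x) * Complex.exp (Complex.I * t / 2)
      = Complex.exp (-(γ + Complex.I * θ) / 2) * Real.exp (-x / 2) := by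
    rw [Complex.ofReal_exp, ← Complex.exp_add, ← Complex.exp_add, solitonPhase]
    push_cast
    ring_nf
  rw [superpose, expComb, ← mul_assoc (Complex.exp _), ← mul_assoc (Complex.exp _), hφ, hχ]
  ring

lemma projOffDiag_superpose {a : ℂ} (ha : a ≠ 0) (γ θ : ℝ) (φ₁ φ₂ χ₁ χ₂ : ℝ → ℝ → ℂ) (t x : ℝ) :
    projOffDiag (superpose a γ θ φ₁ χ₁ t x) (superpose a γ θ φ₂ χ₂ t x)
      = projOffDiag
        (expComb (solitonPhase γ (t + θ) x) (Complex.exp (-(Complex.I * t / 2)) * φ₁ t x)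
          (Complex.exp (Complex.I * t / 2) * χ₁ t x))
        (expComb (solitonPhase γ (t + θ) x) (Complex.exp (-(Complex.I * t / 2)) * φ₂ t x)
          (Complex.exp (Complex.I * t / 2) * χ₂ t x)) := by
  rw [superpose_eq, superpose_eq, projOffDiag_const_mul ha]

lemma SolvesLaxTime.superpose {q φ₁ φ₂ χ₁ χ₂ : ℝ → ℝ → ℂ} (hφ : SolvesLaxTime q φ₁ φ₂)
    (hχ : SolvesLaxTime q χ₁ χ₂) (a : ℂ) (γ θ : ℝ) :
    SolvesLaxTime q (superpose a γ θ φ₁ χ₁) (superpose a γ θ φ₂ χ₂) := by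
  refine ⟨fun t x => ?_, fun t x => ?_⟩
  · refine (((hφ.hasDerivAt_fst t x).const_mul _).add
      ((hχ.hasDerivAt_fst t x).const_mul _)).congr_deriv ?_
    simp only [BacklundNLS.superpose]
    ring
  · refine (((hφ.hasDerivAt_snd t x).const_mul _).add
      ((hχ.hasDerivAt_snd t x).const_mul _)).congr_deriv ?_
    simp only [BacklundNLS.superpose]
    ring

namespace IsJostFlow

variable {q q' q'' φ₁ φ₂ χ₁ χ₂ : ℝ → ℝ → ℂ} {δ : ℝ} {a : ℂ}

lemma superpose_ne_zero (h : IsJostFlow q φ₁ φ₂ χ₁ χ₂ δ) (ha : a ≠ 0) (γ θ t x : ℝ) :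
    superpose a γ θ φ₁ χ₁ t x ≠ 0 ∨ superpose a γ θ φ₂ χ₂ t x ≠ 0 := by
  rw [superpose_eq, superpose_eq]
  exact ((h.pair t).expComb_ne_zero _ x).imp (mul_ne_zero ha) (mul_ne_zero ha)

lemma isDarbouxPair_superpose (h : IsJostFlow q φ₁ φ₂ χ₁ χ₂ δ) (hq : RegularSolution q q' q'')
    (ha : a ≠ 0) (γ θ : ℝ) :
    IsDarbouxPair q q'
      (fun t x => projOffDiag (superpose a γ θ φ₁ χ₁ t x) (superpose a γ θ φ₂ χ₂ t x))
      (fun t x => projDiag (superpose a γ θ φ₁ χ₁ t x) (superpose a γ θ φ₂ χ₂ t x)) := by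
  refine hq.isDarbouxPair (fun t x => ?_) (fun t x => ?_) (h.lax_phi.superpose h.lax_chi a γ θ)
    (h.superpose_ne_zero ha γ θ)
  · rw [funext (superpose_eq a γ θ φ₁ χ₁ t), superpose_eq]
    exact (((h.pair t).hasDerivAt_expComb γ (t + θ) x).1.const_mul a).congr_deriv (by ring)
  · rw [funext (superpose_eq a γ θ φ₂ χ₂ t), superpose_eq]
    exact (((h.pair t).hasDerivAt_expComb γ (t + θ) x).2.const_mul a).congr_deriv (by ring)

lemma eLpNorm_projOffDiag_superpose_add_soliton_le (h : IsJostFlow q φ₁ φ₂ χ₁ χ₂ δ) (ha : a ≠ 0)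
    (γ θ t : ℝ) :
    eLpNorm (fun x => 2 * projOffDiag (superpose a γ θ φ₁ χ₁ t x) (superpose a γ θ φ₂ χ₂ t x)
        + soliton γ (t + θ) x) 2 volume
      ≤ (72 + 32 * eLpNorm sech 2 volume) * ENNReal.ofReal δ := by
  simp only [projOffDiag_superpose ha]
  exact (h.pair t).eLpNorm_two_mul_projOffDiag_add_soliton_le γ (t + θ)

lemma aestronglyMeasurable_projOffDiag_superpose_add_soliton
    (h : IsJostFlow q φ₁ φ₂ χ₁ χ₂ δ) (hq : RegularSolution q q' q'') (ha : a ≠ 0) (γ θ t : ℝ) :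
    AEStronglyMeasurable (fun x =>
      2 * projOffDiag (superpose a γ θ φ₁ χ₁ t x) (superpose a γ θ φ₂ χ₂ t x)
        + soliton γ (t + θ) x) volume :=
  ((continuous_const.mul ((h.isDarbouxPair_superpose hq ha γ θ).isBoundedCoeff_p.continuous_space
    t)).add (continuous_soliton γ _)).aestronglyMeasurable

lemma locallyBoundedInL2_projOffDiag_superpose (h : IsJostFlow q φ₁ φ₂ χ₁ χ₂ δ)
    (hq : RegularSolution q q' q'') (ha : a ≠ 0) (γ θ : ℝ) :
    LocallyBoundedInL2
      fun t x => projOffDiag (superpose a γ θ φ₁ χ₁ t x) (superpose a γ θ φ₂ χ₂ t x) := by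
  have hsech := memLp_sech.eLpNorm_ne_top
  have hsoliton : LocallyBoundedInL2 fun t => soliton γ (t + θ) :=
    ⟨fun t => (continuous_soliton γ _).aestronglyMeasurable,
      fun _ => ⟨_, hsech, Eventually.of_forall fun t => (eLpNorm_soliton γ (t + θ)).le⟩⟩
  have hsum : LocallyBoundedInL2 fun t x =>
      2 * projOffDiag (superpose a γ θ φ₁ χ₁ t x) (superpose a γ θ φ₂ χ₂ t x)
        + soliton γ (t + θ) x :=
    ⟨h.aestronglyMeasurable_projOffDiag_superpose_add_soliton hq ha γ θ,
      fun _ => ⟨(72 + 32 * eLpNorm sech 2 volume) * ENNReal.ofReal δ, by finiteness,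
        Eventually.of_forall (h.eLpNorm_projOffDiag_superpose_add_soliton_le ha γ θ)⟩⟩
  simpa only [add_sub_cancel_right, ← mul_assoc, one_div, inv_mul_cancel₀ (two_ne_zero' ℂ), one_mul]
    using (hsum.sub hsoliton).mul_left (.const (1 / 2))

lemma eLpNorm_backlund_sub_soliton_le (h : IsJostFlow q φ₁ φ₂ χ₁ χ₂ δ)
    (hq : RegularSolution q q' q'') (ha : a ≠ 0) (γ θ t : ℝ) :
    eLpNorm (fun x => backlund q (superpose a γ θ φ₁ χ₁) (superpose a γ θ φ₂ χ₂) t x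
        - soliton γ (t + θ) x) 2 volume
      ≤ (73 + 32 * eLpNorm sech 2 volume) * ENNReal.ofReal δ := by
  have hq2 := (h.pair t).hasL2Bound
  set D : ℝ → ℂ := fun x =>
    2 * projOffDiag (superpose a γ θ φ₁ χ₁ t x) (superpose a γ θ φ₂ χ₂ t x)
      + soliton γ (t + θ) x with hD
  have hDmeas : AEStronglyMeasurable D volume :=
    h.aestronglyMeasurable_projOffDiag_superpose_add_soliton hq ha γ θ t
  have hsplit : (fun x => backlund q (superpose a γ θ φ₁ χ₁) (superpose a γ θ φ₂ χ₂) t x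
      - soliton γ (t + θ) x) = -q t - D := by
    ext x
    simp only [backlund_eq, hD, Pi.sub_apply, Pi.neg_apply]
    ring
  calc eLpNorm (fun x => backlund q (superpose a γ θ φ₁ χ₁) (superpose a γ θ φ₂ χ₂) t x
        - soliton γ (t + θ) x) 2 volume
      ≤ eLpNorm (q t) 2 volume + eLpNorm D 2 volume := by
        rw [hsplit, ← eLpNorm_neg (q t)]
        exact eLpNorm_sub_le hq2.memLp.1.neg hDmeas one_le_two
    _ ≤ ENNReal.ofReal δ + (72 + 32 * eLpNorm sech 2 volume) * ENNReal.ofReal δ :=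
        add_le_add hq2.eLpNorm_le (h.eLpNorm_projOffDiag_superpose_add_soliton_le ha γ θ t)
    _ = (73 + 32 * eLpNorm sech 2 volume) * ENNReal.ofReal δ := by ring

end IsJostFlow

end BacklundNLS

end

theorem mainTheorem2 :
    ∃ ε₀ : ℝ, 0 < ε₀ ∧ ∀ ε : ℝ, 0 < ε → ε < ε₀ → ∃ C : ℝ, 0 < C ∧
      ∀ (q φ₁ φ₂ χ₁ χ₂ : ℝ → ℝ → ℂ) (a : ℂ) (γ θ : ℝ),
        BacklundNLS.IsH3SolutionNLS q →
        eLpNorm (q 0) 2 volume < ENNReal.ofReal ε →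
        BacklundNLS.IsJostPhi (q 0) (φ₁ 0) (φ₂ 0) →
        BacklundNLS.SolvesLaxTime q φ₁ φ₂ →
        BacklundNLS.IsJostChi (q 0) (χ₁ 0) (χ₂ 0) →
        BacklundNLS.SolvesLaxTime q χ₁ χ₂ →
        a ≠ 0 →
        ∀ ψ₁ ψ₂ Q : ℝ → ℝ → ℂ,
          ψ₁ = BacklundNLS.superpose a γ θ φ₁ χ₁ →
          ψ₂ = BacklundNLS.superpose a γ θ φ₂ χ₂ →
          Q = BacklundNLS.backlund q ψ₁ ψ₂ →
          (∀ t x, ‖ψ₁ t x‖ ^ 2 + ‖ψ₂ t x‖ ^ 2 ≠ 0) ∧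
          BacklundNLS.IsH3SolutionNLS Q ∧
          (⨆ t : ℝ, eLpNorm (fun x : ℝ => Q t x
              - Complex.exp (Complex.I * (t + θ)) * (BacklundNLS.sech (x + γ) : ℂ)) 2 volume)
            ≤ ENNReal.ofReal C * eLpNorm (q 0) 2 volume := by
  refine ⟨1 / 100, by norm_num, fun ε _ hε =>
    ⟨73 + 32 * (eLpNorm BacklundNLS.sech 2 volume).toReal, by positivity, ?_⟩⟩
  rintro q φ₁ φ₂ χ₁ χ₂ a γ θ hq hqε hφ hφlax hχ hχlax ha _ _ _ rfl rfl rfl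
  obtain ⟨q', q'', q₃, hreg, hq₃, hweak⟩ := hq.exists_regularSolution
  have hsmall : (eLpNorm (q 0) 2 volume).toReal ≤ 1 / 100 :=
    ((ENNReal.lt_ofReal_iff_toReal_lt hqε.ne_top).1 hqε).le.trans hε.le
  have hflow := hreg.isJostFlow hsmall hφ hφlax hχ hχlax
  have hdarboux := hflow.isDarbouxPair_superpose hreg ha γ θ
  refine ⟨fun t x => ?_, ?_, iSup_le fun t => ?_⟩
  · rcases hflow.superpose_ne_zero ha γ θ t x with hψ | hψ <;> positivity
  · rw [BacklundNLS.backlund_eq]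
    exact hdarboux.isH3SolutionNLS hreg hq₃ hweak
      (hdarboux.continuousInL2_p hreg (hflow.locallyBoundedInL2_projOffDiag_superpose hreg ha γ θ))
  · have hdist := hflow.eLpNorm_backlund_sub_soliton_le hreg ha γ θ t
    simp only [BacklundNLS.soliton, Complex.ofReal_add t θ] at hdist
    rwa [ENNReal.ofReal_add (by norm_num) (by positivity), ENNReal.ofReal_mul (by norm_num),
      ENNReal.ofReal_toReal BacklundNLS.memLp_sech.eLpNorm_ne_top, ENNReal.ofReal_ofNat,
      ENNReal.ofReal_ofNat, ← ENNReal.ofReal_toReal hqε.ne_top]
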